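/- Let $G$ be a compact Hausdorff group with normalized (Radon) Haar measure $m_G$. Let $\Phi:[0,\infty)\to[0,\infty)$ be a Young function (convex, $\Phi(0)=0$, $\Phi(x)\to\infty$ as $x\to\infty$) with complementary function $\Psi(y)=\sup_{x\ge 0}(xy-\Phi(x))\in[0,\infty]$, and assume that $\Phi$ and $\Psi$ both satisfy the $\Delta_2$-condition: there are $K,x_0>0$ with $\Phi(2x)\le K\Phi(x)$ for all $x\ge x_0$, and similarly for $\Psi$. Let $L^\Phi(G)$ be the Orlicz space of (classes of) complex measurable functions $f$ on $G$ with $\|f\|_\Phi=\inf\{k>0:\int_G\Phi(|f|/k)\,dm_G\le 1\}<\infty$. Let $\mu$ be a complex Radon measure on $G$ with $\mu(G)\ne 0$, and put $(\mu*f)(t)=\int_G f(s^{-1}t)\,d\mu(s)$. For a vector measure $\nu$ on the Borel sets of $G$ with values in a complex normed space $X$, and $x'\in X'$, let $\langle\nu,x'\rangle(A)=\langle\nu(A),x'\rangle$. A function $f:G\to\mathbb C$ belongs to $L^1(\nu)$ if $f\in L^1(|\langle\nu,x'\rangle|)$ for all $x'\in X'$ and for each Borel set $A$ there is a unique $x_A\in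 X$ with $\int_A f\,d\langle\nu,x'\rangle=\langle x_A,x'\rangle$ for all $x'\in X'$; then $I_\nu(f)=\int_G f\,d\nu:=x_G$, and $\|f\|_\nu=\sup_{\|x'\|\le 1}\int_G|f|\,d|\langle\nu,x'\rangle|$. Then $f\mapsto\mu*f$ (the integral converges absolutely for almost every $t$) is a bounded linear operator $T_{\Phi,\mu}:L^\Phi(G)\to L^\Phi(G)$, and $\nu=\nu_{\Phi,\mu}:A\mapsto T_{\Phi,\mu}(\chi_A)$ is an $L^\Phi(G)$-valued ($\sigma$-additive) vector measure with the same null sets as $m_G$. Moreover $\|f\|_\nu<\infty$ for all $f\in L^1(\nu)$, and: (1) $L^\Phi(G)\subseteq L^1(\nu)$, and $L^\Phi(G)$ is dense in the optimal domain $L^1(\nu)$ with respect to $\|\cdot\|_\nu$. (2) The integration operator $I_\nu:L^1(\nu)\to L^\Phi(G)$ extends $T_{\Phi,\mu}$, satisfies $\|I_\nu(f)\|_\Phi\le\|f\|_\nu$, and is given by convolution: for every $f\in L^1(\nu)$ the integral defining $(\mu*f)(t)$ converges absolutely for almost every $t\in G$, and $I_\nu(f)=\mu*f$ almost everywhere.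 -/

import Mathlib

open MeasureTheory Filter Topology
open scoped NNReal ENNReal

noncomputable section

namespace OrliczConv

/-- A Young function: a convex function with value `0` at `0` that tends to `∞` at `∞`.
Its value at the point `∞` is never used, so it is a function of a finite variable; it may take
the value `∞`. -/
structure YoungFunction where
  toFun : ℝ≥0 → ℝ≥0∞
  convex' : ConvexOn ℝ≥0 Set.univ toFun
  zero' : toFun 0 = 0
  tendsto' : Tendsto toFun atTop (𝓝 ⊤)

instance : CoeFun YoungFunction (fun _ => ℝ≥0 → ℝ≥0∞) := ⟨YoungFunction.toFun⟩

/-- The complementary function `Ψ(y) = sup {x y - Φ(x) : x ≥ 0}`. The subtraction of `ℝ≥0∞` is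
truncated at `0`, which does not change the supremum as `x = 0` contributes `0`. -/
def complementary (Φ : ℝ≥0 → ℝ≥0∞) (y : ℝ≥0) : ℝ≥0∞ :=
  ⨆ x : ℝ≥0, ((x : ℝ≥0∞) * (y : ℝ≥0∞) - Φ x)

/-- The `Δ₂`-condition (for large arguments). -/
def DeltaTwo (Φ : ℝ≥0 → ℝ≥0∞) : Prop :=
  ∃ K x₀ : ℝ≥0, 0 < K ∧ 0 < x₀ ∧ ∀ x : ℝ≥0, x₀ ≤ x → Φ (2 * x) ≤ (K : ℝ≥0∞) * Φ x

theorem YoungFunction.convex_le (Φ : YoungFunction) {a b x y : ℝ≥0} (hab : a + b = 1) :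
    Φ (a * x + b * y) ≤ (a : ℝ≥0∞) * Φ x + (b : ℝ≥0∞) * Φ y := by
  have h := Φ.convex'.2 (Set.mem_univ x) (Set.mem_univ y) (zero_le (a := a)) (zero_le (a := b)) hab
  simpa [ENNReal.smul_def] using h

theorem YoungFunction.mono (Φ : YoungFunction) : Monotone Φ.toFun := by
  intro x y hxy
  rcases eq_or_ne y 0 with rfl | hy
  · have : x = 0 := le_antisymm hxy zero_le
    rw [this]
  have h1 : x / y ≤ 1 := div_le_one_of_le₀ hxy zero_le
  have h := Φ.convex_le (a := x / y) (b := 1 - x / y) (x := y) (y := 0)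
    (add_tsub_cancel_of_le h1)
  rw [Φ.zero', mul_zero, mul_zero, add_zero, add_zero, div_mul_cancel₀ _ hy] at h
  refine h.trans ?_
  calc ((x / y : ℝ≥0) : ℝ≥0∞) * Φ y ≤ 1 * Φ y := by
        gcongr
        exact_mod_cast h1
    _ = Φ y := one_mul _

section Orlicz

variable {α : Type*} [MeasurableSpace α]

/-- The set of all `k > 0` with `∫ Φ(|f| / k) dm ≤ 1`. -/
def luxSet (Φ : YoungFunction) (m : Measure α) (f : α → ℂ) : Set ℝ≥0 :=
  {k | 0 < k ∧ ∫⁻ x, Φ (‖f x‖₊ / k) ∂m ≤ 1}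

theorem luxSet_congr (Φ : YoungFunction) {m : Measure α} {f g : α → ℂ} (h : f =ᵐ[m] g) :
    luxSet Φ m f = luxSet Φ m g := by
  ext k
  have : ∫⁻ x, Φ (‖f x‖₊ / k) ∂m = ∫⁻ x, Φ (‖g x‖₊ / k) ∂m :=
    lintegral_congr_ae (h.mono fun x hx => by simp only [hx])
  simp only [luxSet, Set.mem_ofPred_eq, this]

theorem mem_luxSet_add (Φ : YoungFunction) {m : Measure α} {f g : α → ℂ}
    (hf : AEStronglyMeasurable f m) {k l : ℝ≥0}
    (hk : k ∈ luxSet Φ m f) (hl : l ∈ luxSet Φ m g) : k + l ∈ luxSet Φ m (f + g) := by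
  obtain ⟨hk0, hk1⟩ := hk
  obtain ⟨hl0, hl1⟩ := hl
  have hs : 0 < k + l := add_pos hk0 hl0
  have hab : k / (k + l) + l / (k + l) = 1 := by
    rw [← add_div, div_self hs.ne']
  refine ⟨hs, ?_⟩
  have hmeas : AEMeasurable (fun x => ((k / (k + l) : ℝ≥0) : ℝ≥0∞) * Φ (‖f x‖₊ / k)) m := by
    have : AEMeasurable (fun x => ‖f x‖₊ / k) m := by
      have := hf.aemeasurable.nnnorm
      exact this.div_const k
    exact (Φ.mono.measurable.comp_aemeasurable this).const_mul _
  calc ∫⁻ x, Φ (‖(f + g) x‖₊ / (k + l)) ∂m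
      ≤ ∫⁻ x, (((k / (k + l) : ℝ≥0) : ℝ≥0∞) * Φ (‖f x‖₊ / k)
          + ((l / (k + l) : ℝ≥0) : ℝ≥0∞) * Φ (‖g x‖₊ / l)) ∂m := by
        refine lintegral_mono fun x => ?_
        refine le_trans (Φ.mono ?_) (Φ.convex_le hab)
        calc ‖(f + g) x‖₊ / (k + l) ≤ (‖f x‖₊ + ‖g x‖₊) / (k + l) := by
              gcongr
              exact nnnorm_add_le _ _
          _ = k / (k + l) * (‖f x‖₊ / k) + l / (k + l) * (‖g x‖₊ / l) := by
              have := hk0.ne'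
              have := hl0.ne'
              have := hs.ne'
              field_simp
    _ = ((k / (k + l) : ℝ≥0) : ℝ≥0∞) * ∫⁻ x, Φ (‖f x‖₊ / k) ∂m
          + ((l / (k + l) : ℝ≥0) : ℝ≥0∞) * ∫⁻ x, Φ (‖g x‖₊ / l) ∂m := by
        rw [lintegral_add_left' hmeas, lintegral_const_mul' _ _ ENNReal.coe_ne_top,
          lintegral_const_mul' _ _ ENNReal.coe_ne_top]
    _ ≤ ((k / (k + l) : ℝ≥0) : ℝ≥0∞) * 1 + ((l / (k + l) : ℝ≥0) : ℝ≥0∞) * 1 := by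
        gcongr
    _ = 1 := by
        rw [mul_one, mul_one, ← ENNReal.coe_add, hab, ENNReal.coe_one]

theorem mem_luxSet_smul (Φ : YoungFunction) {m : Measure α} {f : α → ℂ} {c : ℂ} (hc : c ≠ 0)
    {k : ℝ≥0} (hk : k ∈ luxSet Φ m f) : ‖c‖₊ * k ∈ luxSet Φ m (c • f) := by
  have hc' : 0 < ‖c‖₊ := nnnorm_pos.2 hc
  refine ⟨mul_pos hc' hk.1, ?_⟩
  have : ∀ x, ‖(c • f) x‖₊ / (‖c‖₊ * k) = ‖f x‖₊ / k := fun x => by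
    rw [Pi.smul_apply, nnnorm_smul, mul_div_mul_left _ _ hc'.ne']
  simpa only [this] using hk.2

theorem mem_luxSet_zero (Φ : YoungFunction) (m : Measure α) {k : ℝ≥0} (hk : 0 < k) :
    k ∈ luxSet Φ m 0 := by
  refine ⟨hk, ?_⟩
  simp [Φ.zero']

/-- The Orlicz space `L^Φ(m)` of classes of complex measurable functions with
`∫ Φ(|f| / k) dm ≤ 1` for some `k > 0`. -/
def OrliczSpace (Φ : YoungFunction) (m : Measure α) : Submodule ℂ (α →ₘ[m] ℂ) where
  carrier := {f | (luxSet Φ m f).Nonempty}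
  zero_mem' := ⟨1, by
    rw [luxSet_congr Φ (AEEqFun.coeFn_zero)]
    exact mem_luxSet_zero Φ m one_pos⟩
  add_mem' := by
    rintro f g ⟨k, hk⟩ ⟨l, hl⟩
    refine ⟨k + l, ?_⟩
    rw [luxSet_congr Φ (AEEqFun.coeFn_add f g)]
    exact mem_luxSet_add Φ f.aestronglyMeasurable hk hl
  smul_mem' := by
    rintro c f ⟨k, hk⟩
    rcases eq_or_ne c 0 with rfl | hc
    · refine ⟨1, ?_⟩
      rw [zero_smul, luxSet_congr Φ (AEEqFun.coeFn_zero)]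
      exact mem_luxSet_zero Φ m one_pos
    · refine ⟨‖c‖₊ * k, ?_⟩
      rw [luxSet_congr Φ (AEEqFun.coeFn_smul c f)]
      exact mem_luxSet_smul Φ hc hk

/-- The Luxemburg norm `inf {k > 0 : ∫ Φ(|f| / k) dm ≤ 1}`. -/
def luxNorm (Φ : YoungFunction) (m : Measure α) (f : α → ℂ) : ℝ≥0 := sInf (luxSet Φ m f)

instance (Φ : YoungFunction) (m : Measure α) : Norm (OrliczSpace Φ m) :=
  ⟨fun f => (luxNorm Φ m f.1 : ℝ)⟩

theorem OrliczSpace.norm_def (Φ : YoungFunction) (m : Measure α) (f : OrliczSpace Φ m) :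
    ‖f‖ = (sInf (luxSet Φ m (f.1 : α → ℂ)) : ℝ≥0) := rfl

theorem luxNorm_smul_le (Φ : YoungFunction) (m : Measure α) (c : ℂ) (hc : c ≠ 0)
    (f : OrliczSpace Φ m) : ‖c • f‖ ≤ ‖c‖ * ‖f‖ := by
  rw [OrliczSpace.norm_def, OrliczSpace.norm_def, ← coe_nnnorm, ← NNReal.coe_mul,
    NNReal.coe_le_coe]
  have hc' : 0 < ‖c‖₊ := nnnorm_pos.2 hc
  have h : luxSet Φ m ((c • f : OrliczSpace Φ m).1 : α → ℂ) = luxSet Φ m (c • (f.1 : α → ℂ)) :=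
    luxSet_congr Φ (AEEqFun.coeFn_smul c f.1)
  rw [h, mul_comm, ← div_le_iff₀ hc']
  refine le_csInf f.2 fun k hk => ?_
  rw [div_le_iff₀ hc', mul_comm]
  exact csInf_le (OrderBot.bddBelow _) (mem_luxSet_smul Φ hc hk)

theorem OrliczSpace.norm_zero' (Φ : YoungFunction) (m : Measure α) :
    ‖(0 : OrliczSpace Φ m)‖ = 0 := by
  rw [OrliczSpace.norm_def, NNReal.coe_eq_zero]
  refine le_antisymm (le_of_forall_pos_le_add fun ε hε => ?_) zero_le
  rw [zero_add]
  refine csInf_le (OrderBot.bddBelow _) ?_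
  have h : luxSet Φ m ((0 : OrliczSpace Φ m).1 : α → ℂ) = luxSet Φ m 0 :=
    luxSet_congr Φ AEEqFun.coeFn_zero
  rw [h]
  exact mem_luxSet_zero Φ m hε

theorem ae_zero_of_luxNorm (Φ : YoungFunction) {m : Measure α} {f : α → ℂ}
    (hf : AEStronglyMeasurable f m) (hne : (luxSet Φ m f).Nonempty)
    (h : sInf (luxSet Φ m f) = 0) : f =ᵐ[m] 0 := by
  have key : ∀ k : ℝ≥0, 0 < k → ∫⁻ x, Φ (‖f x‖₊ / k) ∂m ≤ 1 := by
    intro k hk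
    obtain ⟨l, hl, hlk⟩ := exists_lt_of_csInf_lt hne (h ▸ hk)
    refine le_trans (lintegral_mono fun x => Φ.mono ?_) hl.2
    have := hl.1
    gcongr
  have hn : ∀ n : ℕ, m {x | ((1 : ℝ≥0) / (n + 1)) ≤ ‖f x‖₊} = 0 := by
    intro n
    set δ : ℝ≥0 := 1 / (n + 1) with hδ
    have hδ0 : 0 < δ := by positivity
    by_contra hne0
    have hlim : Tendsto (fun t : ℝ≥0 => Φ (δ * t)) atTop (𝓝 ⊤) :=
      Φ.tendsto'.comp (tendsto_id.const_mul_atTop hδ0)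
    have hlim2 : Tendsto (fun t : ℝ≥0 => Φ (δ * t) * m {x | δ ≤ ‖f x‖₊}) atTop (𝓝 ⊤) := by
      have := ENNReal.Tendsto.mul_const (b := m {x | δ ≤ ‖f x‖₊}) hlim
        (Or.inl ENNReal.top_ne_zero)
      rwa [ENNReal.top_mul hne0] at this
    have hev := (hlim2.eventually (lt_mem_nhds ENNReal.one_lt_top)).and (eventually_gt_atTop 0)
    obtain ⟨t, ht1, ht0⟩ := hev.exists
    refine absurd (key t⁻¹ (inv_pos.2 ht0)) (not_le.2 (lt_of_lt_of_le ht1 ?_))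
    have hms : NullMeasurableSet {x | δ ≤ ‖f x‖₊} m :=
      nullMeasurableSet_le aemeasurable_const hf.aemeasurable.nnnorm
    calc Φ (δ * t) * m {x | δ ≤ ‖f x‖₊}
        = ∫⁻ _ in {x | δ ≤ ‖f x‖₊}, Φ (δ * t) ∂m := by rw [setLIntegral_const]
      _ ≤ ∫⁻ x in {x | δ ≤ ‖f x‖₊}, Φ (‖f x‖₊ / t⁻¹) ∂m := by
          refine lintegral_mono_ae ?_
          filter_upwards [ae_restrict_mem₀ hms] with x hx
          refine Φ.mono ?_
          rw [div_inv_eq_mul]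
          have : δ ≤ ‖f x‖₊ := hx
          gcongr
      _ ≤ ∫⁻ x, Φ (‖f x‖₊ / t⁻¹) ∂m := setLIntegral_le_lintegral _ _
  have hall : ∀ᵐ x ∂m, ∀ n : ℕ, ¬ ((1 : ℝ≥0) / (n + 1)) ≤ ‖f x‖₊ := by
    rw [ae_all_iff]
    intro n
    rw [ae_iff]
    simpa only [not_not] using hn n
  filter_upwards [hall] with x hx
  by_contra hx0
  have hpos : 0 < ‖f x‖₊ := nnnorm_pos.2 hx0
  obtain ⟨n, hn⟩ := exists_nat_one_div_lt (K := ℝ≥0) hpos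
  exact hx n hn.le

theorem OrliczSpace.core (Φ : YoungFunction) (m : Measure α) :
    NormedSpace.Core ℂ (OrliczSpace Φ m) where
  norm_nonneg f := NNReal.coe_nonneg _
  norm_smul c f := by
    rcases eq_or_ne c 0 with rfl | hc
    · rw [zero_smul, OrliczSpace.norm_zero', norm_zero, zero_mul]
    refine le_antisymm (luxNorm_smul_le Φ m c hc f) ?_
    have h := luxNorm_smul_le Φ m c⁻¹ (inv_ne_zero hc) (c • f)
    rw [inv_smul_smul₀ hc, norm_inv] at h
    rwa [← le_inv_mul_iff₀ (norm_pos_iff.2 hc)]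
  norm_triangle f g := by
    rw [OrliczSpace.norm_def, OrliczSpace.norm_def, OrliczSpace.norm_def, ← NNReal.coe_add,
      NNReal.coe_le_coe]
    have h : luxSet Φ m ((f + g : OrliczSpace Φ m).1 : α → ℂ)
        = luxSet Φ m ((f.1 : α → ℂ) + (g.1 : α → ℂ)) :=
      luxSet_congr Φ (AEEqFun.coeFn_add f.1 g.1)
    rw [h]
    refine le_of_forall_pos_le_add fun ε hε => ?_
    obtain ⟨k, hk, hk'⟩ := exists_lt_of_csInf_lt f.2
      (lt_add_of_pos_right (sInf (luxSet Φ m (f.1 : α → ℂ))) (half_pos hε))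
    obtain ⟨l, hl, hl'⟩ := exists_lt_of_csInf_lt g.2
      (lt_add_of_pos_right (sInf (luxSet Φ m (g.1 : α → ℂ))) (half_pos hε))
    calc sInf (luxSet Φ m ((f.1 : α → ℂ) + (g.1 : α → ℂ))) ≤ k + l :=
          csInf_le (OrderBot.bddBelow _) (mem_luxSet_add Φ f.1.aestronglyMeasurable hk hl)
      _ ≤ (sInf (luxSet Φ m (f.1 : α → ℂ)) + ε / 2)
            + (sInf (luxSet Φ m (g.1 : α → ℂ)) + ε / 2) := add_le_add hk'.le hl'.le
      _ = sInf (luxSet Φ m (f.1 : α → ℂ)) + sInf (luxSet Φ m (g.1 : α → ℂ)) + ε := by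
          rw [add_add_add_comm, add_halves]
  norm_eq_zero_iff f := by
    refine ⟨fun h => ?_, fun h => by rw [h, OrliczSpace.norm_zero']⟩
    rw [OrliczSpace.norm_def, NNReal.coe_eq_zero] at h
    have h0 := ae_zero_of_luxNorm Φ f.1.aestronglyMeasurable f.2 h
    exact Subtype.ext (AEEqFun.ext (h0.trans AEEqFun.coeFn_zero.symm))

instance (Φ : YoungFunction) (m : Measure α) : NormedAddCommGroup (OrliczSpace Φ m) :=
  NormedAddCommGroup.ofCore (OrliczSpace.core Φ m)

instance (Φ : YoungFunction) (m : Measure α) : NormedSpace ℂ (OrliczSpace Φ m) :=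
  NormedSpace.ofCore (OrliczSpace.core Φ m)

end Orlicz

section VectorMeasure

variable {α : Type*} [MeasurableSpace α] {X : Type*} [NormedAddCommGroup X] [NormedSpace ℂ X]

/-- The complex measure `⟨ν, x'⟩ : A ↦ x'(ν(A))`. -/
def pairing (ν : VectorMeasure α X) (x' : StrongDual ℂ X) : ComplexMeasure α :=
  ν.mapRange (x' : X →ₗ[ℂ] ℂ).toAddMonoidHom x'.continuous

/-- `A` is `ν`-null if `ν` vanishes on all measurable subsets of `A`. -/
def IsNull (ν : VectorMeasure α X) (A : Set α) : Prop :=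
  ∀ B, MeasurableSet B → B ⊆ A → ν B = 0

/-- The integral of a complex function with respect to a complex measure. -/
def cintegral (μ : ComplexMeasure α) (f : α → ℂ) : ℂ :=
  μ.integral f (ContinuousLinearMap.mul ℝ ℂ)

/-- `f` is `ν`-weakly integrable: `f ∈ L¹(|⟨ν, x'⟩|)` for all `x'` in the dual. -/
def WeaklyIntegrable (ν : VectorMeasure α X) (f : α → ℂ) : Prop :=
  ∀ x' : StrongDual ℂ X, Integrable f (pairing ν x').variation

/-- `x` is the integral of `f` over `A` with respect to `ν`:
`∫_A f d⟨ν, x'⟩ = ⟨x, x'⟩` for all `x'` in the dual. -/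
def HasVectorIntegral (ν : VectorMeasure α X) (f : α → ℂ) (A : Set α) (x : X) : Prop :=
  ∀ x' : StrongDual ℂ X, cintegral ((pairing ν x').restrict A) f = x' x

/-- `f` is `ν`-integrable, i.e. `f` belongs to `L¹(ν)`. -/
def MemL1 (ν : VectorMeasure α X) (f : α → ℂ) : Prop :=
  WeaklyIntegrable ν f ∧ ∀ A, MeasurableSet A → ∃! x : X, HasVectorIntegral ν f A x

/-- The norm of `L¹(ν)`: the supremum of `∫ |f| d|⟨ν, x'⟩|` over the closed unit ball of the
dual. -/
def vnorm (ν : VectorMeasure α X) (f : α → ℂ) : ℝ≥0∞ :=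
  ⨆ (x' : StrongDual ℂ X) (_ : ‖x'‖ ≤ 1), ∫⁻ t, ‖f t‖ₑ ∂(pairing ν x').variation

open Classical in
/-- The integration operator `I_ν(f) = ∫ f dν` (with the value `0` off `L¹(ν)`). -/
def integrationOp (ν : VectorMeasure α X) (f : α → ℂ) : X :=
  if h : MemL1 ν f then (h.2 Set.univ MeasurableSet.univ).choose else 0

end VectorMeasure

/-- The convolution `(μ * f)(t) = ∫ f(s⁻¹ t) dμ(s)`. -/
def conv {G : Type*} [Group G] [MeasurableSpace G] (μ : ComplexMeasure G) (f : G → ℂ) (t : G) :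
    ℂ :=
  cintegral μ fun s => f (s⁻¹ * t)

end OrliczConv

end

/-!
By Jensen's inequality for the probability measure `|μ| / |μ|(G)`, convolution with `μ` is bounded
on `L^Φ(G)` with norm at most `|μ|(G)`. The `Δ₂`-condition for `Φ` makes the Luxemburg norm order
continuous, so `ν A = T(χ_A)` is `σ`-additive and every `f` in `L^Φ(G)` is `ν`-integrable with
integral `T f`. For an arbitrary `f` in `L¹(ν)`, the set function `A ↦ ∫_A f dν` is weakly
`σ`-additive, hence `σ`-additive in norm by the Orlicz–Pettis theorem; therefore the tails of `f`
over `{|f| > n}` tend to `0` in `L¹(ν)` and its truncations approximate it.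

The hypothesis `μ(G) ≠ 0` enters through the functional `u ↦ ∫ u dm`: since
`∫ μ * u dm = μ(G) ∫ u dm`, its pairing with `ν` is `μ(G) m`. Hence `ν` and `m` have the same null
sets and `L¹(ν)` embeds continuously in `L¹(m)`. Both `I_ν` and `f ↦ μ * f` are then continuous
from `L¹(ν)` to `L¹(m)` and agree on the dense subspace `L^Φ(G)`.
-/

noncomputable section

namespace OrliczConv

section LuxemburgGauge

variable {α : Type*} [MeasurableSpace α]

/-- The Luxemburg norm with values in `[0, ∞]`. Unlike `luxNorm`, which is an infimum in `ℝ≥0` and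
hence `0` on the empty set, it is `∞` outside the Orlicz space. -/
def eLuxNorm (Φ : YoungFunction) (m : Measure α) (f : α → ℂ) : ℝ≥0∞ :=
  ⨅ k ∈ luxSet Φ m f, (k : ℝ≥0∞)

/-- Membership of a function, as opposed to a class of functions, in the Orlicz space. -/
def MemOrlicz (Φ : YoungFunction) (m : Measure α) (f : α → ℂ) : Prop :=
  AEStronglyMeasurable f m ∧ eLuxNorm Φ m f < ⊤

variable {Φ : YoungFunction} {m : Measure α} {f g : α → ℂ}

theorem eLuxNorm_le_of_mem_luxSet {k : ℝ≥0} (hk : k ∈ luxSet Φ m f) : eLuxNorm Φ m f ≤ k :=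
  iInf₂_le k hk

theorem eLuxNorm_lt_iff {c : ℝ≥0∞} : eLuxNorm Φ m f < c ↔ ∃ k ∈ luxSet Φ m f, (k : ℝ≥0∞) < c := by
  simp only [eLuxNorm, iInf_lt_iff, exists_prop]

theorem eLuxNorm_lt_top_iff : eLuxNorm Φ m f < ⊤ ↔ (luxSet Φ m f).Nonempty := by
  simp only [eLuxNorm_lt_iff, ENNReal.coe_lt_top, and_true, Set.Nonempty]

theorem luxSet_anti (h : ∀ᵐ x ∂m, ‖f x‖ ≤ ‖g x‖) : luxSet Φ m g ⊆ luxSet Φ m f := by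
  refine fun k hk => ⟨hk.1, (lintegral_mono_ae ?_).trans hk.2⟩
  filter_upwards [h] with x hx
  exact Φ.mono (div_le_div_of_nonneg_right (show ‖f x‖₊ ≤ ‖g x‖₊ from hx) zero_le)

theorem eLuxNorm_mono_ae (h : ∀ᵐ x ∂m, ‖f x‖ ≤ ‖g x‖) : eLuxNorm Φ m f ≤ eLuxNorm Φ m g :=
  le_iInf₂ fun _ hk => eLuxNorm_le_of_mem_luxSet (luxSet_anti h hk)

theorem eLuxNorm_congr_ae (h : f =ᵐ[m] g) : eLuxNorm Φ m f = eLuxNorm Φ m g := by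
  rw [eLuxNorm, eLuxNorm, luxSet_congr Φ h]

theorem eLuxNorm_zero : eLuxNorm Φ m (0 : α → ℂ) = 0 := by
  refine le_antisymm (le_of_forall_gt fun c hc => ?_) zero_le
  obtain ⟨k, hk0, hkc⟩ := ENNReal.lt_iff_exists_nnreal_btwn.1 hc
  exact eLuxNorm_lt_iff.2 ⟨k, mem_luxSet_zero Φ m (ENNReal.coe_pos.1 hk0), hkc⟩

theorem eLuxNorm_add_le (hf : AEStronglyMeasurable f m) :
    eLuxNorm Φ m (f + g) ≤ eLuxNorm Φ m f + eLuxNorm Φ m g := by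
  simp only [eLuxNorm, ENNReal.iInf_add, ENNReal.add_iInf]
  exact le_iInf₂ fun l hl => le_iInf₂ fun k hk =>
    eLuxNorm_le_of_mem_luxSet (mem_luxSet_add Φ hf hk hl)

theorem eLuxNorm_const_smul_le (c : ℂ) : eLuxNorm Φ m (c • f) ≤ ‖c‖ₑ * eLuxNorm Φ m f := by
  rcases eq_or_ne c 0 with rfl | hc
  · rw [zero_smul, eLuxNorm_zero]
    exact zero_le
  · have hc' : ‖c‖ₑ ≠ 0 := enorm_ne_zero.2 hc
    simp only [eLuxNorm, ENNReal.mul_iInf_of_ne hc' enorm_ne_top]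
    exact le_iInf₂ fun k hk => eLuxNorm_le_of_mem_luxSet (mem_luxSet_smul Φ hc hk)

namespace MemOrlicz

theorem of_le (hg : MemOrlicz Φ m g) (hf : AEStronglyMeasurable f m)
    (h : ∀ᵐ x ∂m, ‖f x‖ ≤ ‖g x‖) : MemOrlicz Φ m f :=
  ⟨hf, (eLuxNorm_mono_ae h).trans_lt hg.2⟩

theorem zero : MemOrlicz Φ m (0 : α → ℂ) :=
  ⟨aestronglyMeasurable_zero, eLuxNorm_zero.trans_lt ENNReal.zero_lt_top⟩

theorem add (hf : MemOrlicz Φ m f) (hg : MemOrlicz Φ m g) : MemOrlicz Φ m (f + g) :=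
  ⟨hf.1.add hg.1, (eLuxNorm_add_le hf.1).trans_lt (ENNReal.add_lt_top.2 ⟨hf.2, hg.2⟩)⟩

theorem const_smul (hf : MemOrlicz Φ m f) (c : ℂ) : MemOrlicz Φ m (c • f) :=
  ⟨hf.1.const_smul c,
    (eLuxNorm_const_smul_le c).trans_lt (ENNReal.mul_lt_top enorm_lt_top hf.2)⟩

theorem sub (hf : MemOrlicz Φ m f) (hg : MemOrlicz Φ m g) : MemOrlicz Φ m (f - g) := by
  simpa only [neg_one_smul, ← sub_eq_add_neg] using hf.add (hg.const_smul (-1))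

theorem indicator (hf : MemOrlicz Φ m f) {A : Set α} (hA : MeasurableSet A) :
    MemOrlicz Φ m (A.indicator f) :=
  hf.of_le (hf.1.indicator hA) (ae_of_all _ fun _ => norm_indicator_le_norm_self _ _)

/-- The class of a function in the Orlicz space. -/
def toOrlicz (hf : MemOrlicz Φ m f) : OrliczSpace Φ m :=
  ⟨AEEqFun.mk f hf.1, by
    change (luxSet Φ m (AEEqFun.mk f hf.1)).Nonempty
    rw [luxSet_congr Φ (AEEqFun.coeFn_mk f hf.1)]
    exact eLuxNorm_lt_top_iff.1 hf.2⟩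

theorem coeFn_toOrlicz (hf : MemOrlicz Φ m f) : (hf.toOrlicz : α →ₘ[m] ℂ) =ᵐ[m] f :=
  AEEqFun.coeFn_mk f hf.1

theorem toOrlicz_congr (hf : MemOrlicz Φ m f) (hg : MemOrlicz Φ m g) (h : f =ᵐ[m] g) :
    hf.toOrlicz = hg.toOrlicz :=
  Subtype.ext (AEEqFun.mk_eq_mk.2 h)

theorem toOrlicz_zero : (zero (Φ := Φ) (m := m)).toOrlicz = 0 := rfl

theorem toOrlicz_add (hf : MemOrlicz Φ m f) (hg : MemOrlicz Φ m g) :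
    (hf.add hg).toOrlicz = hf.toOrlicz + hg.toOrlicz := rfl

theorem toOrlicz_sub (hf : MemOrlicz Φ m f) (hg : MemOrlicz Φ m g) :
    (hf.sub hg).toOrlicz = hf.toOrlicz - hg.toOrlicz := rfl

theorem toOrlicz_const_smul (hf : MemOrlicz Φ m f) (c : ℂ) :
    (hf.const_smul c).toOrlicz = c • hf.toOrlicz := rfl

end MemOrlicz

namespace OrliczSpace

theorem enorm_eq_eLuxNorm (u : OrliczSpace Φ m) : ‖u‖ₑ = eLuxNorm Φ m (u : α →ₘ[m] ℂ) := by
  rw [← ofReal_norm, norm_def, ENNReal.ofReal_coe_nnreal, ENNReal.coe_sInf u.2]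
  rfl

theorem memOrlicz (u : OrliczSpace Φ m) : MemOrlicz Φ m (u : α →ₘ[m] ℂ) :=
  ⟨AEEqFun.aestronglyMeasurable _, eLuxNorm_lt_top_iff.2 u.2⟩

theorem toOrlicz_memOrlicz (u : OrliczSpace Φ m) : (memOrlicz u).toOrlicz = u :=
  Subtype.ext (AEEqFun.ext (memOrlicz u).coeFn_toOrlicz)

end OrliczSpace

theorem MemOrlicz.enorm_toOrlicz (hf : MemOrlicz Φ m f) : ‖hf.toOrlicz‖ₑ = eLuxNorm Φ m f := by
  rw [OrliczSpace.enorm_eq_eLuxNorm, eLuxNorm_congr_ae hf.coeFn_toOrlicz]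

end LuxemburgGauge

section YoungFunction

variable {Φ : YoungFunction}

theorem YoungFunction.le_mul_of_le_one (Φ : YoungFunction) {a : ℝ≥0} (ha : a ≤ 1) (x : ℝ≥0) :
    Φ (a * x) ≤ a * Φ x := by
  simpa [Φ.zero'] using Φ.convex_le (x := x) (y := 0) (add_tsub_cancel_of_le ha)

theorem YoungFunction.exists_le_add_mul (Φ : YoungFunction) :
    ∃ C : ℝ≥0, 0 < C ∧ ∀ x : ℝ≥0, (x : ℝ≥0∞) ≤ C + C * Φ x := by
  obtain ⟨c, hc1, hc0⟩ := ((Φ.tendsto'.eventually (lt_mem_nhds ENNReal.one_lt_top)).and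
    (eventually_gt_atTop 0)).exists
  refine ⟨c, hc0, fun x => ?_⟩
  rcases le_total x c with hx | hx
  · exact le_add_right (ENNReal.coe_le_coe.2 hx)
  · have hx0 : x ≠ 0 := (hc0.trans_le hx).ne'
    have h : 1 ≤ ((c / x : ℝ≥0) : ℝ≥0∞) * Φ x := by
      refine hc1.le.trans ?_
      simpa only [div_mul_cancel₀ c hx0] using
        Φ.le_mul_of_le_one (div_le_one_of_le₀ hx zero_le) x
    refine le_add_left ?_
    calc (x : ℝ≥0∞) ≤ x * (((c / x : ℝ≥0) : ℝ≥0∞) * Φ x) := le_mul_of_one_le_right' h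
      _ = c * Φ x := by rw [← mul_assoc, ← ENNReal.coe_mul, mul_div_cancel₀ _ hx0]

theorem YoungFunction.tendsto_nhds_zero (hfin : ∀ x : ℝ≥0, Φ x ≠ ⊤) :
    Tendsto Φ.toFun (𝓝 0) (𝓝 0) := by
  have h : Tendsto (fun x : ℝ≥0 => (x : ℝ≥0∞) * Φ 1) (𝓝 0) (𝓝 0) := by
    simpa using ENNReal.Tendsto.mul_const (ENNReal.continuous_coe.tendsto 0) (Or.inr (hfin 1))
  refine tendsto_of_tendsto_of_tendsto_of_le_of_le' tendsto_const_nhds h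
    (Eventually.of_forall fun _ => zero_le) ?_
  filter_upwards [Iic_mem_nhds zero_lt_one] with x hx
  simpa only [mul_one] using Φ.le_mul_of_le_one hx 1

theorem YoungFunction.exists_pos_mul_le_one (hfin : ∀ x : ℝ≥0, Φ x ≠ ⊤) {M : ℝ≥0∞} (hM : M ≠ ⊤) :
    ∃ x : ℝ≥0, 0 < x ∧ Φ x * M ≤ 1 := by
  have h : Tendsto (fun x : ℝ≥0 => Φ x * M) (𝓝 0) (𝓝 0) := by
    simpa using ENNReal.Tendsto.mul_const (tendsto_nhds_zero hfin) (Or.inr hM)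
  have h1 : ∀ᶠ x in 𝓝[>] (0 : ℝ≥0), Φ x * M ≤ 1 :=
    (h.eventually (ge_mem_nhds zero_lt_one)).filter_mono nhdsWithin_le_nhds
  obtain ⟨x, hx, hx0⟩ := (h1.and self_mem_nhdsWithin).exists
  exact ⟨x, hx0, hx⟩

theorem DeltaTwo.exists_le_mul_add (hfin : ∀ x : ℝ≥0, Φ x ≠ ⊤) (hΦ : DeltaTwo Φ) :
    ∃ K L : ℝ≥0, ∀ x : ℝ≥0, Φ (2 * x) ≤ K * Φ x + L := by
  obtain ⟨K, x₀, -, -, h⟩ := hΦ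
  refine ⟨K, (Φ (2 * x₀)).toNNReal, fun x => ?_⟩
  rw [ENNReal.coe_toNNReal (hfin _)]
  rcases le_total x₀ x with hx | hx
  · exact le_add_right (h x hx)
  · exact le_add_left (Φ.mono (mul_le_mul_of_nonneg_left hx zero_le))

end YoungFunction

section FiniteMeasure

variable {α : Type*} [MeasurableSpace α] {Φ : YoungFunction} {m : Measure α} {f g : α → ℂ}

theorem YoungFunction.aemeasurable_comp_nnnorm_div (Φ : YoungFunction)
    (hf : AEStronglyMeasurable f m) (k : ℝ≥0) : AEMeasurable (fun x => Φ (‖f x‖₊ / k)) m :=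
  Φ.mono.measurable.comp_aemeasurable (hf.aemeasurable.nnnorm.div_const k)

variable [IsFiniteMeasure m]

theorem exists_lintegral_enorm_le_mul_eLuxNorm (Φ : YoungFunction) (m : Measure α)
    [IsFiniteMeasure m] :
    ∃ C : ℝ≥0, ∀ f : α → ℂ, ∫⁻ x, ‖f x‖ₑ ∂m ≤ C * eLuxNorm Φ m f := by
  obtain ⟨C, hC0, hC⟩ := Φ.exists_le_add_mul
  set D : ℝ≥0 := C * (m Set.univ).toNNReal + C with hD
  have hD0 : (D : ℝ≥0∞) ≠ 0 := ENNReal.coe_ne_zero.2 (add_pos_of_nonneg_of_pos zero_le hC0).ne'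
  refine ⟨D, fun f => ?_⟩
  simp only [eLuxNorm, ENNReal.mul_iInf_of_ne hD0 ENNReal.coe_ne_top]
  refine le_iInf₂ fun k hk => ?_
  calc ∫⁻ x, ‖f x‖ₑ ∂m = ∫⁻ x, (k : ℝ≥0∞) * ((‖f x‖₊ / k : ℝ≥0) : ℝ≥0∞) ∂m := by
        simp only [← ENNReal.coe_mul, mul_div_cancel₀ _ hk.1.ne', enorm]
    _ ≤ ∫⁻ x, (k : ℝ≥0∞) * (C + C * Φ (‖f x‖₊ / k)) ∂m := by
        gcongr
        exact hC _
    _ = k * (C * m Set.univ + C * ∫⁻ x, Φ (‖f x‖₊ / k) ∂m) := by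
        rw [lintegral_const_mul' _ _ ENNReal.coe_ne_top, lintegral_add_left measurable_const,
          lintegral_const, lintegral_const_mul' _ _ ENNReal.coe_ne_top]
    _ ≤ k * (C * m Set.univ + C * 1) := by
        gcongr
        exact hk.2
    _ = D * k := by
        rw [hD, ENNReal.coe_add, ENNReal.coe_mul, ENNReal.coe_toNNReal (measure_ne_top _ _),
          mul_one, mul_comm]

theorem MemOrlicz.integrable (hf : MemOrlicz Φ m f) : Integrable f m := by
  obtain ⟨C, hC⟩ := exists_lintegral_enorm_le_mul_eLuxNorm Φ m
  exact ⟨hf.1, (hC f).trans_lt (ENNReal.mul_lt_top ENNReal.coe_lt_top hf.2)⟩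

theorem exists_eLuxNorm_le_mul_of_bound (hfin : ∀ x : ℝ≥0, Φ x ≠ ⊤) (m : Measure α)
    [IsFiniteMeasure m] :
    ∃ C : ℝ≥0, 0 < C ∧ ∀ (f : α → ℂ) (c : ℝ≥0), 0 < c → (∀ᵐ x ∂m, ‖f x‖₊ ≤ c) →
      eLuxNorm Φ m f ≤ C * c := by
  obtain ⟨x, hx0, hx⟩ := YoungFunction.exists_pos_mul_le_one hfin (measure_ne_top m Set.univ)
  refine ⟨x⁻¹, inv_pos.2 hx0, fun f c hc hf => ?_⟩
  have hk : 0 < x⁻¹ * c := mul_pos (inv_pos.2 hx0) hc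
  rw [← ENNReal.coe_mul]
  refine eLuxNorm_le_of_mem_luxSet ⟨hk, ?_⟩
  calc ∫⁻ t, Φ (‖f t‖₊ / (x⁻¹ * c)) ∂m ≤ ∫⁻ _, Φ x ∂m := by
        refine lintegral_mono_ae ?_
        filter_upwards [hf] with t ht
        refine Φ.mono ((div_le_iff₀ hk).2 ?_)
        rwa [mul_inv_cancel_left₀ hx0.ne']
    _ ≤ 1 := by rwa [lintegral_const]

theorem memOrlicz_of_bound (hfin : ∀ x : ℝ≥0, Φ x ≠ ⊤) (hf : AEStronglyMeasurable f m) (c : ℝ≥0)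
    (hc : ∀ᵐ x ∂m, ‖f x‖₊ ≤ c) : MemOrlicz Φ m f := by
  obtain ⟨C, -, hC⟩ := exists_eLuxNorm_le_mul_of_bound hfin m
  exact ⟨hf, (hC f (c + 1) (by positivity) (hc.mono fun x hx => hx.trans le_self_add)).trans_lt
    (ENNReal.mul_lt_top ENNReal.coe_lt_top ENNReal.coe_lt_top)⟩

theorem memOrlicz_simpleFunc (hfin : ∀ x : ℝ≥0, Φ x ≠ ⊤) (F : SimpleFunc α ℂ) :
    MemOrlicz Φ m F := by
  obtain ⟨c, hc⟩ := F.exists_forall_norm_le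
  exact memOrlicz_of_bound hfin F.stronglyMeasurable.aestronglyMeasurable c.toNNReal
    (ae_of_all _ fun x => NNReal.coe_le_coe.1 ((hc x).trans (Real.le_coe_toNNReal c)))

theorem memOrlicz_indicator_one (hfin : ∀ x : ℝ≥0, Φ x ≠ ⊤) {A : Set α} (hA : MeasurableSet A) :
    MemOrlicz Φ m (A.indicator 1) :=
  (memOrlicz_of_bound hfin aestronglyMeasurable_one 1 (by simp)).indicator hA

end FiniteMeasure

section DeltaTwo

variable {α : Type*} [MeasurableSpace α] {Φ : YoungFunction} {m : Measure α} [IsFiniteMeasure m]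
  {f g : α → ℂ}

theorem DeltaTwo.lintegral_comp_nnnorm_div_lt_top (hΦ : DeltaTwo Φ) (hfin : ∀ x : ℝ≥0, Φ x ≠ ⊤)
    (hf : eLuxNorm Φ m f < ⊤) {ε : ℝ≥0} (hε : 0 < ε) : ∫⁻ x, Φ (‖f x‖₊ / ε) ∂m < ⊤ := by
  obtain ⟨k, hk0, hk⟩ := eLuxNorm_lt_top_iff.1 hf
  obtain ⟨K, L, hKL⟩ := hΦ.exists_le_mul_add hfin
  have hpow : ∀ n : ℕ, ∫⁻ x, Φ (2 ^ n * (‖f x‖₊ / k)) ∂m < ⊤ := by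
    intro n
    induction n with
    | zero => simpa using hk.trans_lt ENNReal.one_lt_top
    | succ n ih =>
      calc ∫⁻ x, Φ (2 ^ (n + 1) * (‖f x‖₊ / k)) ∂m
          ≤ ∫⁻ x, (K * Φ (2 ^ n * (‖f x‖₊ / k)) + L) ∂m := by
            simp only [pow_succ', mul_assoc]
            exact lintegral_mono fun x => hKL _
        _ = K * ∫⁻ x, Φ (2 ^ n * (‖f x‖₊ / k)) ∂m + L * m Set.univ := by
            rw [lintegral_add_right _ measurable_const, lintegral_const,
              lintegral_const_mul' _ _ ENNReal.coe_ne_top]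
        _ < ⊤ := ENNReal.add_lt_top.2 ⟨ENNReal.mul_lt_top ENNReal.coe_lt_top ih,
            ENNReal.mul_lt_top ENNReal.coe_lt_top (measure_lt_top _ _)⟩
  obtain ⟨n, hn⟩ := pow_unbounded_of_one_lt (k / ε) (one_lt_two (α := ℝ≥0))
  refine (lintegral_mono fun x => Φ.mono ?_).trans_lt (hpow n)
  calc ‖f x‖₊ / ε = k / ε * (‖f x‖₊ / k) := by
        have := hk0.ne'
        field_simp
    _ ≤ 2 ^ n * (‖f x‖₊ / k) := mul_le_mul_of_nonneg_right hn.le zero_le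

theorem DeltaTwo.tendsto_eLuxNorm_of_dominated (hΦ : DeltaTwo Φ) (hfin : ∀ x : ℝ≥0, Φ x ≠ ⊤)
    {ι : Type*} {l : Filter ι} [l.IsCountablyGenerated] (hg : eLuxNorm Φ m g < ⊤) {F : ι → α → ℂ}
    (hF : ∀ i, AEStronglyMeasurable (F i) m) (hle : ∀ i, ∀ᵐ x ∂m, ‖F i x‖ ≤ ‖g x‖)
    (hlim : ∀ᵐ x ∂m, Tendsto (fun i => F i x) l (𝓝 0)) :
    Tendsto (fun i => eLuxNorm Φ m (F i)) l (𝓝 0) := by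
  refine ENNReal.tendsto_nhds_zero.2 fun ε hε => ?_
  obtain ⟨δ, hδ0, hδε⟩ := ENNReal.lt_iff_exists_nnreal_btwn.1 hε
  have hδ : 0 < δ := ENNReal.coe_pos.1 hδ0
  have hmodular : Tendsto (fun i => ∫⁻ x, Φ (‖F i x‖₊ / δ) ∂m) l (𝓝 (∫⁻ _, 0 ∂m)) := by
    refine tendsto_lintegral_filter_of_dominated_convergence' (fun x => Φ (‖g x‖₊ / δ))
      (Eventually.of_forall fun i => Φ.aemeasurable_comp_nnnorm_div (hF i) δ)
      (Eventually.of_forall fun i => ?_) (hΦ.lintegral_comp_nnnorm_div_lt_top hfin hg hδ).ne ?_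
    · filter_upwards [hle i] with x hx
      exact Φ.mono (div_le_div_of_nonneg_right (show ‖F i x‖₊ ≤ ‖g x‖₊ from hx) zero_le)
    · filter_upwards [hlim] with x hx
      refine (YoungFunction.tendsto_nhds_zero hfin).comp ?_
      simpa using hx.nnnorm.div_const δ
  rw [lintegral_zero] at hmodular
  filter_upwards [hmodular.eventually (ge_mem_nhds zero_lt_one)] with i hi
  exact (eLuxNorm_le_of_mem_luxSet ⟨hδ, hi⟩).trans hδε.le

theorem DeltaTwo.tendsto_toOrlicz_of_dominated (hΦ : DeltaTwo Φ) (hfin : ∀ x : ℝ≥0, Φ x ≠ ⊤)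
    {ι : Type*} {l : Filter ι} [l.IsCountablyGenerated] (hg : MemOrlicz Φ m g)
    (hf : MemOrlicz Φ m f) {F : ι → α → ℂ} (hF : ∀ i, MemOrlicz Φ m (F i))
    (hle : ∀ i, ∀ᵐ x ∂m, ‖F i x‖ ≤ ‖g x‖)
    (hlim : ∀ᵐ x ∂m, Tendsto (fun i => F i x) l (𝓝 (f x))) :
    Tendsto (fun i => (hF i).toOrlicz) l (𝓝 hf.toOrlicz) := by
  rw [tendsto_iff_norm_sub_tendsto_zero, ← tendsto_zero_iff_norm_tendsto_zero,
    tendsto_zero_iff_enorm_tendsto_zero]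
  simp only [← MemOrlicz.toOrlicz_sub, MemOrlicz.enorm_toOrlicz]
  have hsum : eLuxNorm Φ m (fun x => ((‖g x‖ + ‖f x‖ : ℝ) : ℂ)) < ⊤ := by
    have hnorm : ∀ {h : α → ℂ}, MemOrlicz Φ m h → MemOrlicz Φ m (fun x => (‖h x‖ : ℂ)) :=
      fun hh => hh.of_le (Complex.continuous_ofReal.comp_aestronglyMeasurable hh.1.norm)
        (ae_of_all _ fun x => by simp)
    simp only [Complex.ofReal_add]
    exact ((hnorm hg).add (hnorm hf)).2
  refine hΦ.tendsto_eLuxNorm_of_dominated hfin hsum (fun i => ((hF i).sub hf).1) (fun i => ?_) ?_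
  · filter_upwards [hle i] with x hx
    rw [Complex.norm_real, Real.norm_of_nonneg (by positivity)]
    exact (norm_sub_le _ _).trans (add_le_add_left hx _)
  · filter_upwards [hlim] with x hx
    simpa using hx.sub_const (f x)

end DeltaTwo

section ComplexMeasure

variable {α : Type*} [MeasurableSpace α]

theorem variation_le_two_mul_semivariation (κ : ComplexMeasure α) (S : Set α) :
    κ.variation S ≤ 2 * κ.semivariation S := by
  set part : StrongDual ℝ ℂ → SignedMeasure α := fun ℓ =>
    κ.mapRange (ℓ : ℂ →+ ℝ) ℓ.continuous
  have hpart_le : ∀ ℓ : StrongDual ℝ ℂ, ‖ℓ‖ = 1 → (part ℓ).variation S ≤ κ.semivariation S :=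
    fun ℓ hℓ => le_biSup (fun ℓ => (part ℓ).variation S)
      (show ‖ℓ‖ₑ ≤ 1 by rw [← ofReal_norm, hℓ, ENNReal.ofReal_one])
  have hle : κ.variation ≤ (part Complex.reCLM).variation + (part Complex.imCLM).variation := by
    refine VectorMeasure.variation_le_of_forall_enorm_le fun E _ => ?_
    refine le_trans ?_ (add_le_add (VectorMeasure.enorm_measure_le_variation _ E)
      (VectorMeasure.enorm_measure_le_variation _ E))
    rw [← ofReal_norm, ← ofReal_norm, ← ofReal_norm,
      ← ENNReal.ofReal_add (norm_nonneg _) (norm_nonneg _)]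
    exact ENNReal.ofReal_le_ofReal (Complex.norm_le_abs_re_add_abs_im _)
  rw [two_mul]
  exact (hle S).trans (add_le_add (hpart_le _ Complex.reCLM_norm) (hpart_le _ Complex.imCLM_norm))

theorem variation_le_four_mul (κ : ComplexMeasure α) {S : Set α} (hS : MeasurableSet S)
    {c : ℝ≥0∞} (h : ∀ A ⊆ S, MeasurableSet A → ‖κ A‖ₑ ≤ c) : κ.variation S ≤ 4 * c := by
  have hsemi : κ.semivariation S ≤ 2 * c := by
    by_contra! hlt
    obtain ⟨A, hAS, hA, hAc⟩ := κ.exists_subset_lt_enorm_apply_of_lt_semivariation hS hlt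
    exact hAc.not_ge (mul_le_mul_right (h A hAS hA) 2)
  calc κ.variation S ≤ 2 * κ.semivariation S := variation_le_two_mul_semivariation κ S
    _ ≤ 2 * (2 * c) := by gcongr
    _ = 4 * c := by ring

instance isFiniteMeasure_variation (κ : ComplexMeasure α) : IsFiniteMeasure κ.variation :=
  ⟨(variation_le_two_mul_semivariation κ Set.univ).trans_lt (ENNReal.mul_lt_top (by simp)
    (VectorMeasure.semivariation_apply_le_bound.trans_lt ENNReal.coe_lt_top))⟩

theorem nnnorm_mul_apply (x y : ℂ) : ‖ContinuousLinearMap.mul ℝ ℂ x y‖₊ = ‖x‖₊ * ‖y‖₊ :=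
  nnnorm_mul x y

variable {ρ : ComplexMeasure α} {f g : α → ℂ}

theorem enorm_cintegral_le (ρ : ComplexMeasure α) (f : α → ℂ) :
    ‖cintegral ρ f‖ₑ ≤ ∫⁻ x, ‖f x‖ₑ ∂ρ.variation := by
  refine VectorMeasure.enorm_integral_le_lintegral_enorm_transpose.trans_eq ?_
  rw [VectorMeasure.variation_transpose_eq _ _ nnnorm_mul_apply]

theorem norm_cintegral_le (ρ : ComplexMeasure α) (f : α → ℂ) :
    ‖cintegral ρ f‖ ≤ ∫ x, ‖f x‖ ∂ρ.variation := by
  refine VectorMeasure.norm_integral_le_integral_norm.trans ?_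
  simp

theorem cintegral_congr (h : f =ᵐ[ρ.variation] g) : cintegral ρ f = cintegral ρ g :=
  VectorMeasure.integral_congr_ae h

theorem cintegral_add (hf : Integrable f ρ.variation) (hg : Integrable g ρ.variation) :
    cintegral ρ (f + g) = cintegral ρ f + cintegral ρ g :=
  VectorMeasure.integral_add hf hg

theorem cintegral_sub (hf : Integrable f ρ.variation) (hg : Integrable g ρ.variation) :
    cintegral ρ (f - g) = cintegral ρ f - cintegral ρ g :=
  VectorMeasure.integral_sub hf hg

theorem cintegral_const_smul (c : ℂ) (f : α → ℂ) : cintegral ρ (c • f) = c * cintegral ρ f :=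
  setToFun_smul (dominatedFinMeasAdditive_cbmApplyMeasure ρ (ContinuousLinearMap.mul ℝ ℂ))
    (fun c A x => mul_assoc c x (ρ A)) c f

theorem cintegral_indicator {A : Set α} (hA : MeasurableSet A) (f : α → ℂ) :
    cintegral ρ (A.indicator f) = cintegral (ρ.restrict A) f :=
  VectorMeasure.integral_indicator hA

theorem cintegral_indicator_one {A : Set α} (hA : MeasurableSet A) :
    cintegral ρ (A.indicator 1) = ρ A := by
  rw [cintegral_indicator hA]
  refine (VectorMeasure.integral_const (μ := ρ.restrict A)
    (B := ContinuousLinearMap.mul ℝ ℂ) 1).trans ?_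
  rw [VectorMeasure.restrict_apply _ hA MeasurableSet.univ, Set.univ_inter]
  exact one_mul _

theorem tendsto_cintegral_of_dominated {ι : Type*} {l : Filter ι} [l.IsCountablyGenerated]
    {F : ι → α → ℂ} (hg : Integrable g ρ.variation)
    (hF : ∀ i, AEStronglyMeasurable (F i) ρ.variation)
    (hle : ∀ i, ∀ᵐ x ∂ρ.variation, ‖F i x‖ ≤ ‖g x‖)
    (hlim : ∀ᵐ x ∂ρ.variation, Tendsto (fun i => F i x) l (𝓝 (f x))) :
    Tendsto (fun i => cintegral ρ (F i)) l (𝓝 (cintegral ρ f)) :=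
  VectorMeasure.tendsto_integral_filter_of_dominated_convergence _
    (Eventually.of_forall hF) (Eventually.of_forall hle) hg.norm hlim

theorem lintegral_variation_le (hf : Integrable f ρ.variation) {c : ℝ≥0∞}
    (h : ∀ A, MeasurableSet A → ‖cintegral ρ (A.indicator f)‖ₑ ≤ c) :
    ∫⁻ x, ‖f x‖ₑ ∂ρ.variation ≤ 4 * c := by
  have hdensity := VectorMeasure.variation_withDensity hf nnnorm_mul_apply
  rw [VectorMeasure.variation_transpose_eq _ _ nnnorm_mul_apply] at hdensity
  rw [← setLIntegral_univ, ← withDensity_apply _ MeasurableSet.univ, ← hdensity]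
  refine variation_le_four_mul _ MeasurableSet.univ fun A _ hA => ?_
  rw [VectorMeasure.withDensity_apply hf]
  exact (congrArg enorm (cintegral_indicator hA f)).symm.trans_le (h A hA)

end ComplexMeasure

section Integration

variable {α : Type*} [MeasurableSpace α] {X : Type*} [NormedAddCommGroup X] [NormedSpace ℂ X]
  {ν : VectorMeasure α X} {f g : α → ℂ}

theorem pairing_apply (ν : VectorMeasure α X) (x' : StrongDual ℂ X) (A : Set α) :
    pairing ν x' A = x' (ν A) := rfl

theorem lintegral_variation_pairing_le (ν : VectorMeasure α X) (x' : StrongDual ℂ X)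
    (f : α → ℂ) : ∫⁻ t, ‖f t‖ₑ ∂(pairing ν x').variation ≤ ‖x'‖ₑ * vnorm ν f := by
  obtain ⟨u', hu', c, hc, rfl⟩ : ∃ u' : StrongDual ℂ X, ‖u'‖ ≤ 1 ∧
      ∃ c : ℂ, ‖c‖ₑ = ‖x'‖ₑ ∧ x' = c • u' := by
    rcases eq_or_ne x' 0 with rfl | hx'
    · exact ⟨0, by rw [norm_zero]; exact zero_le_one, 0,
        by rw [← ofReal_norm, ← ofReal_norm, norm_zero, norm_zero],
        (zero_smul ℂ (0 : StrongDual ℂ X)).symm⟩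
    · refine ⟨(‖x'‖ : ℂ)⁻¹ • x', (norm_smul_inv_norm hx').le, ‖x'‖, ?_, ?_⟩
      · rw [← ofReal_norm, Complex.norm_real, norm_norm, ofReal_norm]
      · exact (smul_inv_smul₀ (Complex.ofReal_ne_zero.2 (norm_ne_zero_iff.2 hx')) x').symm
  have hsmul : pairing ν (c • u') = c • pairing ν u' := rfl
  rw [hsmul, VectorMeasure.variation_smul, lintegral_smul_measure, ← hc]
  exact mul_le_mul_right (le_iSup₂ (f := fun (x' : StrongDual ℂ X) (_ : ‖x'‖ ≤ 1) =>
    ∫⁻ t, ‖f t‖ₑ ∂(pairing ν x').variation) u' hu') _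

theorem HasVectorIntegral.unique {A : Set α} {x y : X} (hx : HasVectorIntegral ν f A x)
    (hy : HasVectorIntegral ν f A y) : x = y :=
  (SeparatingDual.eq_iff_forall_dual_eq (R := ℂ)).2 fun x' => (hx x').symm.trans (hy x')

theorem memL1_of_forall_exists (hf : WeaklyIntegrable ν f)
    (h : ∀ A, MeasurableSet A → ∃ x, HasVectorIntegral ν f A x) : MemL1 ν f :=
  ⟨hf, fun A hA => let ⟨x, hx⟩ := h A hA; ⟨x, hx, fun _ hy => hy.unique hx⟩⟩

theorem hasVectorIntegral_univ_iff {x : X} :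
    HasVectorIntegral ν f Set.univ x ↔
      ∀ x' : StrongDual ℂ X, cintegral (pairing ν x') f = x' x := by
  simp only [HasVectorIntegral, VectorMeasure.restrict_univ]

theorem HasVectorIntegral.indicator {A B : Set α} {x : X} (hA : MeasurableSet A)
    (hB : MeasurableSet B) (hx : HasVectorIntegral ν f (A ∩ B) x) :
    HasVectorIntegral ν (B.indicator f) A x := fun x' => by
  rw [← hx x', cintegral_indicator hB, VectorMeasure.restrict_restrict _ hB hA, Set.inter_comm]

theorem HasVectorIntegral.sub (hf : WeaklyIntegrable ν f) (hg : WeaklyIntegrable ν g) {A : Set α}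
    (hA : MeasurableSet A) {x y : X} (hx : HasVectorIntegral ν f A x)
    (hy : HasVectorIntegral ν g A y) : HasVectorIntegral ν (f - g) A (x - y) := fun x' => by
  rw [map_sub, ← hx x', ← hy x', ← cintegral_indicator hA, ← cintegral_indicator hA,
    ← cintegral_indicator hA, Set.indicator_sub',
    cintegral_sub ((hf x').indicator hA) ((hg x').indicator hA)]

theorem vnorm_congr (h : ∀ x', f =ᵐ[(pairing ν x').variation] g) : vnorm ν f = vnorm ν g :=
  iSup_congr fun x' => iSup_congr fun _ =>
    lintegral_congr_ae ((h x').mono fun _ ht => congrArg enorm ht)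

namespace MemL1

theorem indicator (hf : MemL1 ν f) {B : Set α} (hB : MeasurableSet B) :
    MemL1 ν (B.indicator f) :=
  memL1_of_forall_exists (fun x' => (hf.1 x').indicator hB) fun A hA =>
    let ⟨x, hx, _⟩ := hf.2 (A ∩ B) (hA.inter hB)
    ⟨x, hx.indicator hA hB⟩

theorem sub (hf : MemL1 ν f) (hg : MemL1 ν g) : MemL1 ν (f - g) :=
  memL1_of_forall_exists (fun x' => (hf.1 x').sub (hg.1 x')) fun A hA =>
    let ⟨x, hx, _⟩ := hf.2 A hA
    let ⟨y, hy, _⟩ := hg.2 A hA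
    ⟨x - y, hx.sub hf.1 hg.1 hA hy⟩

theorem hasVectorIntegral_integrationOp (hf : MemL1 ν f) :
    HasVectorIntegral ν f Set.univ (integrationOp ν f) := by
  rw [integrationOp, dif_pos hf]
  exact (hf.2 Set.univ MeasurableSet.univ).choose_spec.1

theorem cintegral_pairing (hf : MemL1 ν f) (x' : StrongDual ℂ X) :
    cintegral (pairing ν x') f = x' (integrationOp ν f) :=
  hasVectorIntegral_univ_iff.1 hf.hasVectorIntegral_integrationOp x'

theorem integrationOp_eq (hf : MemL1 ν f) {x : X} (hx : HasVectorIntegral ν f Set.univ x) :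
    integrationOp ν f = x := hf.hasVectorIntegral_integrationOp.unique hx

theorem integrationOp_sub (hf : MemL1 ν f) (hg : MemL1 ν g) :
    integrationOp ν (f - g) = integrationOp ν f - integrationOp ν g :=
  (hf.sub hg).integrationOp_eq <| hf.hasVectorIntegral_integrationOp.sub hf.1 hg.1
    MeasurableSet.univ hg.hasVectorIntegral_integrationOp

theorem enorm_integrationOp_le (hf : MemL1 ν f) : ‖integrationOp ν f‖ₑ ≤ vnorm ν f := by
  obtain ⟨x', hx', h⟩ := exists_dual_vector'' ℂ (integrationOp ν f)
  calc ‖integrationOp ν f‖ₑ = ‖cintegral (pairing ν x') f‖ₑ := by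
        rw [hf.cintegral_pairing, h, ← ofReal_norm, ← ofReal_norm]
        simp
    _ ≤ ∫⁻ t, ‖f t‖ₑ ∂(pairing ν x').variation := enorm_cintegral_le _ _
    _ ≤ vnorm ν f := le_iSup₂ (f := fun (x' : StrongDual ℂ X) (_ : ‖x'‖ ≤ 1) =>
        ∫⁻ t, ‖f t‖ₑ ∂(pairing ν x').variation) x' hx'

theorem vnorm_le_of_forall (hf : MemL1 ν f) {c : ℝ≥0∞}
    (h : ∀ A, MeasurableSet A → ‖integrationOp ν (A.indicator f)‖ₑ ≤ c) :
    vnorm ν f ≤ 4 * c := by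
  refine iSup₂_le fun x' hx' => lintegral_variation_le (hf.1 x') fun A hA => ?_
  rw [(hf.indicator hA).cintegral_pairing]
  refine le_trans ((x'.le_opENorm _).trans (mul_le_of_le_one_left zero_le ?_)) (h A hA)
  rw [← ofReal_norm]
  exact ENNReal.ofReal_le_one.2 hx'

theorem vnorm_lt_top (hf : MemL1 ν f) : vnorm ν f < ⊤ := by
  let e : {A : Set α // MeasurableSet A} → StrongDual ℂ (StrongDual ℂ X) := fun A =>
    NormedSpace.inclusionInDoubleDual ℂ X (integrationOp ν (A.1.indicator f))
  have hpointwise : ∀ x' : StrongDual ℂ X, ∃ C, ∀ A, ‖e A x'‖ ≤ C := by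
    refine fun x' => ⟨∫ t, ‖f t‖ ∂(pairing ν x').variation, fun A => ?_⟩
    change ‖x' (integrationOp ν (A.1.indicator f))‖ ≤ _
    rw [← (hf.indicator A.2).cintegral_pairing]
    exact (norm_cintegral_le _ _).trans (integral_mono ((hf.1 x').indicator A.2).norm
      (hf.1 x').norm fun t => norm_indicator_le_norm_self _ _)
  obtain ⟨C, hC⟩ := banach_steinhaus hpointwise
  refine (hf.vnorm_le_of_forall (c := ENNReal.ofReal C) fun A hA => ?_).trans_lt
    (ENNReal.mul_lt_top (by simp) ENNReal.ofReal_lt_top)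
  rw [← ofReal_norm, ← (NormedSpace.inclusionInDoubleDualLi ℂ (E := X)).norm_map]
  exact ENNReal.ofReal_le_ofReal (hC ⟨A, hA⟩)

end MemL1

end Integration

section WeakContinuity

variable {X : Type*} [NormedAddCommGroup X] [NormedSpace ℂ X]

theorem norm_le_of_tendsto_dual {ι : Type*} {l : Filter ι} {u : ι → X} {x : X} {c : ℝ}
    (h : ∀ x' : StrongDual ℂ X, Tendsto (fun i => x' (u i)) l (𝓝 (x' x)))
    (hc : ∃ᶠ i in l, ‖u i‖ ≤ c) : ‖x‖ ≤ c := by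
  obtain ⟨x', hx', hx'x⟩ := exists_dual_vector'' ℂ x
  have hmem : ‖x' x‖ ∈ Set.Iic c :=
    isClosed_Iic.mem_of_frequently_of_tendsto (hc.mono fun i hi => (x'.le_opNorm _).trans <|
      (mul_le_of_le_one_left (norm_nonneg _) hx').trans hi) (h x').norm
  rwa [hx'x, RCLike.norm_ofReal, abs_norm] at hmem

variable {K : Type*} [TopologicalSpace K] {u : K → X}

theorem isClosed_preimage_of_continuous_dual
    (hu : ∀ x' : StrongDual ℂ X, Continuous fun s => x' (u s)) {C : Set X} (hC : Convex ℝ C)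
    (hC' : IsClosed C) : IsClosed (u ⁻¹' C) := by
  rw [← RCLike.iInter_halfSpaces_eq' (𝕜 := ℂ) hC hC']
  simp only [Set.preimage_iInter]
  exact isClosed_iInter fun x' => isClosed_iInter fun c => isClosed_iInter fun _ =>
    isClosed_le (RCLike.continuous_re.comp (hu x')) continuous_const

theorem isSeparable_range_of_continuous_dual [TopologicalSpace.SeparableSpace K]
    (hu : ∀ x' : StrongDual ℂ X, Continuous fun s => x' (u s)) :
    TopologicalSpace.IsSeparable (Set.range u) := by
  obtain ⟨D, hDc, hD⟩ := TopologicalSpace.exists_countable_dense K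
  let Y := (Submodule.span ℂ (u '' D)).topologicalClosure
  have hclosed : IsClosed (u ⁻¹' Y) :=
    isClosed_preimage_of_continuous_dual hu (Y.restrictScalars ℝ).convex
      (Submodule.isClosed_topologicalClosure _)
  have hDY : D ⊆ u ⁻¹' Y := fun s hs =>
    subset_closure (Submodule.subset_span (Set.mem_image_of_mem u hs))
  refine ((hDc.image u).isSeparable.span (R := ℂ)).closure.mono ?_
  rintro _ ⟨s, rfl⟩
  exact hclosed.closure_subset_iff.2 hDY (hD s)

/-- Balls are weakly closed and, the range being separable, countably many of them cover it, so
Baire's theorem applies. -/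
theorem exists_isOpen_norm_sub_le_of_continuous_dual [TopologicalSpace.SeparableSpace K]
    [BaireSpace K] [Nonempty K] (hu : ∀ x' : StrongDual ℂ X, Continuous fun s => x' (u s))
    {ε : ℝ} (hε : 0 < ε) :
    ∃ U : Set K, IsOpen U ∧ U.Nonempty ∧ ∀ s ∈ U, ∀ t ∈ U, ‖u s - u t‖ ≤ ε := by
  obtain ⟨c, hc, hcu⟩ := isSeparable_range_of_continuous_dual hu
  have := hc.to_subtype
  have hcover : ⋃ y : c, u ⁻¹' Metric.closedBall (y : X) (ε / 2) = Set.univ := by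
    refine Set.eq_univ_of_forall fun s => ?_
    obtain ⟨y, hy, hsy⟩ := Metric.mem_closure_iff.1 (hcu ⟨s, rfl⟩) (ε / 2) (half_pos hε)
    exact Set.mem_iUnion.2 ⟨⟨y, hy⟩, hsy.le⟩
  obtain ⟨y, hy⟩ := nonempty_interior_of_iUnion_of_closed (fun y : c =>
    isClosed_preimage_of_continuous_dual hu (convex_closedBall (y : X) _)
      Metric.isClosed_closedBall) hcover
  have hball := interior_subset (s := u ⁻¹' Metric.closedBall (y : X) (ε / 2))
  refine ⟨_, isOpen_interior, hy, fun s hs t ht => ?_⟩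
  rw [← dist_eq_norm, ← add_halves ε]
  exact dist_triangle_right (u s) (u t) y |>.trans
    (add_le_add (hball hs) (hball ht))

end WeakContinuity

section SubfamilyUnion

variable {α β : Type*} {B : ℕ → Set α}

/-- The union of the subfamily of `B` selected by a point `S` of the Cantor space. -/
def subfamilyUnion (B : ℕ → Set α) (S : ℕ → Bool) : Set α := ⋃ k, ⋃ _ : S k, B k

theorem measurableSet_subfamilyUnion [MeasurableSpace α] (hB : ∀ k, MeasurableSet (B k))
    (S : ℕ → Bool) : MeasurableSet (subfamilyUnion B S) :=
  .iUnion fun k => .iUnion fun _ => hB k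

theorem mem_subfamilyUnion_iff (hd : Pairwise (Function.onFun Disjoint B)) {k : ℕ} {t : α}
    (ht : t ∈ B k) (S : ℕ → Bool) : t ∈ subfamilyUnion B S ↔ S k := by
  refine ⟨fun h => ?_, fun h => Set.mem_iUnion₂.2 ⟨k, h, ht⟩⟩
  obtain ⟨j, hj, htj⟩ := Set.mem_iUnion₂.1 h
  rwa [hd.eq (Set.not_disjoint_iff.2 ⟨t, ht, htj⟩)]

theorem eventually_mem_subfamilyUnion_iff (hd : Pairwise (Function.onFun Disjoint B))
    (S : ℕ → Bool) (t : α) :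
    ∀ᶠ S' in 𝓝 S, t ∈ subfamilyUnion B S' ↔ t ∈ subfamilyUnion B S := by
  by_cases ht : ∃ k, t ∈ B k
  · obtain ⟨k, hk⟩ := ht
    filter_upwards [(continuous_apply k).continuousAt.eventually_mem
      ((isOpen_discrete {S k}).mem_nhds rfl)] with S' hS'
    rw [mem_subfamilyUnion_iff hd hk, mem_subfamilyUnion_iff hd hk, Set.mem_singleton_iff.1 hS']
  · push Not at ht
    simp [subfamilyUnion, ht]

theorem indicator_subfamilyUnion_update_sub [AddGroup β]
    (hd : Pairwise (Function.onFun Disjoint B)) (S : ℕ → Bool) (n : ℕ) (f : α → β) :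
    (subfamilyUnion B (Function.update S n true)).indicator f -
      (subfamilyUnion B (Function.update S n false)).indicator f = (B n).indicator f := by
  classical
  ext t
  by_cases ht : ∃ k, t ∈ B k
  · obtain ⟨k, hk⟩ := ht
    rcases eq_or_ne k n with rfl | hkn
    · simp [mem_subfamilyUnion_iff hd hk, hk]
    · have hn : t ∉ B n := Set.disjoint_left.1 (hd hkn) hk
      simp [Set.indicator_apply, mem_subfamilyUnion_iff hd hk, hkn, hn]
  · push Not at ht
    simp [subfamilyUnion, ht]

end SubfamilyUnion

section OrliczPettis

variable {α : Type*} [MeasurableSpace α] {X : Type*} [NormedAddCommGroup X] [NormedSpace ℂ X]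
  {ν : VectorMeasure α X} {f : α → ℂ}

namespace MemL1

theorem tendsto_dual_integrationOp_indicator (hf : MemL1 ν f) {ι : Type*} {l : Filter ι}
    [l.IsCountablyGenerated] {A : ι → Set α} {B : Set α} (hA : ∀ i, MeasurableSet (A i))
    (hB : MeasurableSet B) (hlim : ∀ t, ∀ᶠ i in l, t ∈ A i ↔ t ∈ B) (x' : StrongDual ℂ X) :
    Tendsto (fun i => x' (integrationOp ν ((A i).indicator f))) l
      (𝓝 (x' (integrationOp ν (B.indicator f)))) := by
  simp only [← (hf.indicator (hA _)).cintegral_pairing, ← (hf.indicator hB).cintegral_pairing]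
  refine tendsto_cintegral_of_dominated (hf.1 x') (fun i => ((hf.1 x').indicator (hA i)).1)
    (fun i => ae_of_all _ fun t => norm_indicator_le_norm_self _ _) (ae_of_all _ fun t => ?_)
  exact tendsto_const_nhds.congr' ((hlim t).mono fun i hi => by
    classical simp only [Set.indicator_apply, hi])

/-- The integrals over the unions of subfamilies of `B` depend weakly continuously on the
subfamily, a point of the Cantor space, so some open set of subfamilies has small oscillation. -/
theorem tendsto_integrationOp_indicator_of_disjoint (hf : MemL1 ν f) {B : ℕ → Set α}
    (hB : ∀ n, MeasurableSet (B n)) (hd : Pairwise (Function.onFun Disjoint B)) :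
    Tendsto (fun n => integrationOp ν ((B n).indicator f)) atTop (𝓝 0) := by
  have hV := measurableSet_subfamilyUnion hB
  have hcont : ∀ x' : StrongDual ℂ X, Continuous fun S =>
      x' (integrationOp ν ((subfamilyUnion B S).indicator f)) := fun x' =>
    continuous_iff_continuousAt.2 fun S => hf.tendsto_dual_integrationOp_indicator hV (hV S)
      (eventually_mem_subfamilyUnion_iff hd S) x'
  refine NormedAddGroup.tendsto_nhds_zero.2 fun ε hε => ?_
  obtain ⟨U, hU, ⟨S, hS⟩, hosc⟩ := exists_isOpen_norm_sub_le_of_continuous_dual hcont (half_pos hε)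
  have hupdate : ∀ b : Bool, ∀ᶠ n in atTop, Function.update S n b ∈ U := fun b => by
    refine (tendsto_pi_nhds.2 fun k => ?_).eventually_mem (hU.mem_nhds hS)
    refine tendsto_const_nhds.congr' ((eventually_ne_atTop k).mono fun n hn => ?_)
    exact (Function.update_of_ne hn.symm b S).symm
  filter_upwards [hupdate true, hupdate false] with n htrue hfalse
  rw [← indicator_subfamilyUnion_update_sub hd S n f,
    (hf.indicator (hV _)).integrationOp_sub (hf.indicator (hV _))]
  exact (hosc _ htrue _ hfalse).trans_lt (half_lt_self hε)

theorem exists_lt_norm_integrationOp_diff (hf : MemL1 ν f) {D : ℕ → Set α}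
    (hD : ∀ n, MeasurableSet (D n)) (hanti : Antitone D) (hempty : ⋂ n, D n = ∅) {ε : ℝ}
    {A : Set α} (hA : MeasurableSet A) (hε : ε < ‖integrationOp ν (A.indicator f)‖) (n : ℕ) :
    ∃ k > n, ε < ‖integrationOp ν ((A \ D k).indicator f)‖ := by
  by_contra! hle
  refine hε.not_ge (norm_le_of_tendsto_dual (hf.tendsto_dual_integrationOp_indicator
    (fun k => hA.diff (hD k)) hA fun t => ?_) ((eventually_gt_atTop n).mono hle).frequently)
  obtain ⟨k, hk⟩ : ∃ k, t ∉ D k :=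
    not_forall.1 fun ht => Set.notMem_empty t (hempty ▸ Set.mem_iInter.2 ht)
  filter_upwards [eventually_ge_atTop k] with j hj
  exact and_iff_left fun htj => hk (hanti hj htj)

/-- Otherwise a gliding hump yields disjoint sets `B j ⊆ D (φ j) \ D (φ (j + 1))` over which the
integrals of `f` stay away from `0`. -/
theorem exists_forall_subset_norm_integrationOp_indicator_le (hf : MemL1 ν f) {D : ℕ → Set α}
    (hD : ∀ n, MeasurableSet (D n)) (hanti : Antitone D) (hempty : ⋂ n, D n = ∅) {ε : ℝ}
    (hε : 0 < ε) :
    ∃ n, ∀ A ⊆ D n, MeasurableSet A → ‖integrationOp ν (A.indicator f)‖ ≤ ε := by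
  by_contra! hlarge
  have hstep : ∀ n, ∃ k > n, ∃ B ⊆ D n \ D k, MeasurableSet B ∧
      ε < ‖integrationOp ν (B.indicator f)‖ := fun n => by
    obtain ⟨A, hAD, hA, hεA⟩ := hlarge n
    obtain ⟨k, hk, hεk⟩ := hf.exists_lt_norm_integrationOp_diff hD hanti hempty hA hεA n
    exact ⟨k, hk, A \ D k, Set.sdiff_subset_sdiff_left hAD, hA.diff (hD k), hεk⟩
  choose next hnext B hBD hB hεB using hstep
  let φ : ℕ → ℕ := fun j => next^[j] 0
  have hφ : ∀ j, φ (j + 1) = next (φ j) := fun j => Function.iterate_succ_apply' next j 0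
  have hmono : Monotone φ := monotone_nat_of_le_succ fun j => hφ j ▸ (hnext (φ j)).le
  have hdisj : Pairwise (Function.onFun Disjoint fun j => B (φ j)) :=
    (pairwise_disjoint_on _).2 fun i j hij => Set.disjoint_left.2 fun t hi hj =>
      (hBD _ hi).2 (hanti (hφ i ▸ hmono hij) (hBD _ hj).1)
  have hlim := hf.tendsto_integrationOp_indicator_of_disjoint (fun j => hB (φ j)) hdisj
  obtain ⟨j, hj⟩ := (NormedAddGroup.tendsto_nhds_zero.1 hlim ε hε).exists
  exact hj.not_gt (hεB (φ j))

theorem tendsto_vnorm_indicator (hf : MemL1 ν f) {D : ℕ → Set α}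
    (hD : ∀ n, MeasurableSet (D n)) (hanti : Antitone D) (hempty : ⋂ n, D n = ∅) :
    Tendsto (fun n => vnorm ν ((D n).indicator f)) atTop (𝓝 0) := by
  refine ENNReal.tendsto_atTop_zero.2 fun ε hε => ?_
  obtain ⟨δ, hδ, hδε⟩ := ENNReal.exists_nnreal_pos_mul_lt (a := 4) (by simp) hε.ne'
  obtain ⟨N, hN⟩ := hf.exists_forall_subset_norm_integrationOp_indicator_le hD hanti hempty hδ
  refine ⟨N, fun n hn => ((hf.indicator (hD n)).vnorm_le_of_forall (c := δ) fun A hA => ?_).trans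
    ((mul_comm _ _).trans_le hδε.le)⟩
  rw [Set.indicator_indicator, ← ofReal_norm, ← ENNReal.ofReal_coe_nnreal]
  exact ENNReal.ofReal_le_ofReal
    (hN _ (Set.inter_subset_right.trans (hanti hn)) (hA.inter (hD n)))

end MemL1

end OrliczPettis

section OperatorMeasure

variable {α : Type*} [MeasurableSpace α] {X : Type*} [NormedAddCommGroup X] [NormedSpace ℂ X]
  {Φ : YoungFunction} {m : Measure α} {f : α → ℂ}

theorem exists_simpleFunc_norm_le_tendsto (hf : AEStronglyMeasurable f m) :
    ∃ F : ℕ → SimpleFunc α ℂ, (∀ n, ∀ᵐ x ∂m, ‖F n x‖ ≤ ‖((2 : ℂ) • f) x‖) ∧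
      ∀ᵐ x ∂m, Tendsto (fun n => F n x) atTop (𝓝 (f x)) := by
  have hmk := hf.stronglyMeasurable_mk.measurable
  refine ⟨SimpleFunc.approxOn _ hmk Set.univ 0 (Set.mem_univ 0), fun n => ?_, ?_⟩
  · filter_upwards [hf.ae_eq_mk] with x hx
    rw [Pi.smul_apply, norm_smul, Complex.norm_ofNat, two_mul, hx]
    exact SimpleFunc.norm_approxOn_zero_le hmk (Set.mem_univ 0) x n
  · filter_upwards [hf.ae_eq_mk] with x hx
    rw [hx]
    exact SimpleFunc.tendsto_approxOn hmk (Set.mem_univ 0) (by simp)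

variable [IsFiniteMeasure m]

theorem sum_toOrlicz_indicator_one (hfin : ∀ x : ℝ≥0, Φ x ≠ ⊤) {ι : Type*} {A : ι → Set α}
    (hA : ∀ i, MeasurableSet (A i)) (hd : Pairwise (Function.onFun Disjoint A)) (s : Finset ι) :
    ∑ i ∈ s, (memOrlicz_indicator_one (m := m) hfin (hA i)).toOrlicz =
      (memOrlicz_indicator_one hfin (s.measurableSet_biUnion fun i _ => hA i)).toOrlicz := by
  classical
  induction s using Finset.induction_on with
  | empty =>
    refine MemOrlicz.toOrlicz_zero.symm.trans (MemOrlicz.toOrlicz_congr _ _ ?_)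
    simp only [Finset.notMem_empty, Set.iUnion_of_empty, Set.iUnion_empty, Set.indicator_empty']
    rfl
  | insert i s hi ih =>
    rw [Finset.sum_insert hi, ih, ← MemOrlicz.toOrlicz_add]
    refine MemOrlicz.toOrlicz_congr _ _ (EventuallyEq.of_eq ?_)
    rw [Finset.set_biUnion_insert, Set.indicator_union_of_disjoint]
    · rfl
    · exact Set.disjoint_iUnion₂_right.2 fun j hj => hd (ne_of_mem_of_not_mem hj hi).symm

theorem hasSum_toOrlicz_indicator_one (hfin : ∀ x : ℝ≥0, Φ x ≠ ⊤) (hΦ : DeltaTwo Φ)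
    {A : ℕ → Set α} (hA : ∀ i, MeasurableSet (A i))
    (hd : Pairwise (Function.onFun Disjoint A)) :
    HasSum (fun i => (memOrlicz_indicator_one (m := m) hfin (hA i)).toOrlicz)
      (memOrlicz_indicator_one hfin (MeasurableSet.iUnion hA)).toOrlicz := by
  rw [HasSum, SummationFilter.unconditional_filter]
  simp only [sum_toOrlicz_indicator_one hfin hA hd]
  refine hΦ.tendsto_toOrlicz_of_dominated hfin
    (memOrlicz_indicator_one hfin (MeasurableSet.iUnion hA)) _ _
    (fun s => ae_of_all _ fun x => norm_indicator_le_of_subset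
      (Set.iUnion₂_subset fun i _ => Set.subset_iUnion A i) _ _) (ae_of_all _ fun x => ?_)
  exact (tendsto_indicator_biUnion_finset A (1 : α → ℂ) x).mono_right (pure_le_nhds _)

open Classical in
/-- The vector measure `A ↦ T(χ_A)` of an operator `T` on an Orlicz space. -/
def operatorMeasure (hfin : ∀ x : ℝ≥0, Φ x ≠ ⊤) (hΦ : DeltaTwo Φ)
    (T : OrliczSpace Φ m →L[ℂ] X) : VectorMeasure α X where
  measureOf' A :=
    if hA : MeasurableSet A then T (memOrlicz_indicator_one hfin hA).toOrlicz else 0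
  empty' := by
    rw [dif_pos MeasurableSet.empty, ← map_zero T, ← MemOrlicz.toOrlicz_zero]
    exact congrArg T (MemOrlicz.toOrlicz_congr _ _ (by rw [Set.indicator_empty']))
  not_measurable' A hA := dif_neg hA
  m_iUnion' A hA hd := by
    simp only [dif_pos (hA _), dif_pos (MeasurableSet.iUnion hA)]
    exact T.hasSum (hasSum_toOrlicz_indicator_one hfin hΦ hA hd)

variable {hfin : ∀ x : ℝ≥0, Φ x ≠ ⊤} {hΦ : DeltaTwo Φ} {T : OrliczSpace Φ m →L[ℂ] X}

theorem operatorMeasure_apply {A : Set α} (hA : MeasurableSet A) :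
    operatorMeasure hfin hΦ T A = T (memOrlicz_indicator_one hfin hA).toOrlicz := dif_pos hA

theorem operatorMeasure_eq_zero {A : Set α} (hA : m A = 0) : operatorMeasure hfin hΦ T A = 0 := by
  by_cases hm : MeasurableSet A
  · rw [operatorMeasure_apply hm, ← map_zero T, ← MemOrlicz.toOrlicz_zero]
    exact congrArg T (MemOrlicz.toOrlicz_congr _ _ (indicator_meas_zero hA))
  · exact VectorMeasure.not_measurable _ hm

theorem pairing_operatorMeasure_absolutelyContinuous (x' : StrongDual ℂ X) :
    (pairing (operatorMeasure hfin hΦ T) x').variation ≪ m := by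
  refine Measure.AbsolutelyContinuous.mk fun A hA h0 => ?_
  rw [VectorMeasure.variation_apply_eq_zero hA]
  intro B hB _
  rw [pairing_apply, operatorMeasure_eq_zero (measure_mono_null hB h0), map_zero]

theorem cintegral_pairing_operatorMeasure_simpleFunc (x' : StrongDual ℂ X)
    (F : SimpleFunc α ℂ) :
    cintegral (pairing (operatorMeasure hfin hΦ T) x') F =
      x' (T (memOrlicz_simpleFunc hfin F).toOrlicz) := by
  induction F using SimpleFunc.induction with
  | @const c A hA =>
    have hpiecewise : ⇑(SimpleFunc.piecewise A hA (SimpleFunc.const α c) (SimpleFunc.const α 0))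
        = c • A.indicator (1 : α → ℂ) := by
      ext x
      by_cases hx : x ∈ A <;> simp [hx]
    refine (congrArg (cintegral _) hpiecewise).trans ?_
    rw [cintegral_const_smul, cintegral_indicator_one hA, pairing_apply,
      operatorMeasure_apply hA, ← smul_eq_mul, ← map_smul, ← map_smul,
      ← MemOrlicz.toOrlicz_const_smul]
    exact congrArg (x' ∘ T) (MemOrlicz.toOrlicz_congr _ _ (EventuallyEq.of_eq hpiecewise.symm))
  | @add F G _ hF hG =>
    refine (cintegral_add F.integrable_of_isFiniteMeasure
      G.integrable_of_isFiniteMeasure).trans ?_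
    rw [hF, hG, ← map_add, ← map_add, ← MemOrlicz.toOrlicz_add]
    rfl

theorem lintegral_pairing_operatorMeasure_simpleFunc_le (x' : StrongDual ℂ X)
    (F : SimpleFunc α ℂ) :
    ∫⁻ x, ‖F x‖ₑ ∂(pairing (operatorMeasure hfin hΦ T) x').variation ≤
      4 * (‖x'‖ₑ * (‖T‖ₑ * eLuxNorm Φ m F)) := by
  refine lintegral_variation_le F.integrable_of_isFiniteMeasure fun A hA => ?_
  rw [← SimpleFunc.coe_restrict F hA, cintegral_pairing_operatorMeasure_simpleFunc]
  refine (x'.le_opENorm _).trans (mul_le_mul_right ((T.le_opENorm _).trans ?_) _)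
  rw [MemOrlicz.enorm_toOrlicz, SimpleFunc.coe_restrict F hA]
  exact mul_le_mul_right
    (eLuxNorm_mono_ae (ae_of_all _ fun _ => norm_indicator_le_norm_self _ _)) _

namespace MemOrlicz

theorem weaklyIntegrable_operatorMeasure (hf : MemOrlicz Φ m f) :
    WeaklyIntegrable (operatorMeasure hfin hΦ T) f := fun x' => by
  have hac := pairing_operatorMeasure_absolutelyContinuous (hfin := hfin) (hΦ := hΦ) (T := T) x'
  obtain ⟨F, hle, hlim⟩ := exists_simpleFunc_norm_le_tendsto hf.1
  refine ⟨hf.1.mono_ac hac, ?_⟩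
  let c : ℝ≥0∞ := 4 * (‖x'‖ₑ * (‖T‖ₑ * eLuxNorm Φ m ((2 : ℂ) • f)))
  have hc : c < ⊤ := ENNReal.mul_lt_top (by simp) (ENNReal.mul_lt_top enorm_lt_top
    (ENNReal.mul_lt_top enorm_lt_top (hf.const_smul 2).2))
  have hbound : ∀ n, ∫⁻ x, ‖F n x‖ₑ ∂(pairing (operatorMeasure hfin hΦ T) x').variation ≤ c :=
    fun n => (lintegral_pairing_operatorMeasure_simpleFunc_le x' (F n)).trans
      (mul_le_mul_right (mul_le_mul_right (mul_le_mul_right (eLuxNorm_mono_ae (hle n)) _) _) _)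
  calc ∫⁻ x, ‖f x‖ₑ ∂(pairing (operatorMeasure hfin hΦ T) x').variation
      = ∫⁻ x, liminf (fun n => ‖F n x‖ₑ) atTop
          ∂(pairing (operatorMeasure hfin hΦ T) x').variation :=
        lintegral_congr_ae
          ((show ∀ᵐ x ∂_, _ from hac.ae_le hlim).mono fun x hx => hx.enorm.liminf_eq.symm)
    _ ≤ liminf (fun n => ∫⁻ x, ‖F n x‖ₑ
          ∂(pairing (operatorMeasure hfin hΦ T) x').variation) atTop :=
        lintegral_liminf_le fun n => (F n).measurable.enorm
    _ ≤ c := liminf_le_of_frequently_le' (Frequently.of_forall hbound)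
    _ < ⊤ := hc

theorem cintegral_pairing_operatorMeasure (hf : MemOrlicz Φ m f) (x' : StrongDual ℂ X) :
    cintegral (pairing (operatorMeasure hfin hΦ T) x') f = x' (T hf.toOrlicz) := by
  have hac := pairing_operatorMeasure_absolutelyContinuous (hfin := hfin) (hΦ := hΦ) (T := T) x'
  obtain ⟨F, hle, hlim⟩ := exists_simpleFunc_norm_le_tendsto hf.1
  have hint : Tendsto (fun n => cintegral (pairing (operatorMeasure hfin hΦ T) x') (F n)) atTop
      (𝓝 (cintegral (pairing (operatorMeasure hfin hΦ T) x') f)) :=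
    tendsto_cintegral_of_dominated ((hf.const_smul 2).weaklyIntegrable_operatorMeasure x')
      (fun n => (F n).aestronglyMeasurable) (fun n => hac.ae_le (hle n)) (hac.ae_le hlim)
  have hclass := hΦ.tendsto_toOrlicz_of_dominated hfin (hf.const_smul 2) hf
    (fun n => memOrlicz_simpleFunc hfin (F n)) hle hlim
  simp only [cintegral_pairing_operatorMeasure_simpleFunc] at hint
  exact tendsto_nhds_unique hint (((x'.continuous.comp T.continuous).tendsto _).comp hclass)

theorem hasVectorIntegral_operatorMeasure (hf : MemOrlicz Φ m f) {A : Set α}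
    (hA : MeasurableSet A) :
    HasVectorIntegral (operatorMeasure hfin hΦ T) f A (T (hf.indicator hA).toOrlicz) :=
  fun x' => by rw [← cintegral_indicator hA, (hf.indicator hA).cintegral_pairing_operatorMeasure]

theorem memL1_operatorMeasure (hf : MemOrlicz Φ m f) : MemL1 (operatorMeasure hfin hΦ T) f :=
  memL1_of_forall_exists hf.weaklyIntegrable_operatorMeasure
    fun _ hA => ⟨_, hf.hasVectorIntegral_operatorMeasure hA⟩

theorem integrationOp_operatorMeasure (hf : MemOrlicz Φ m f) :
    integrationOp (operatorMeasure hfin hΦ T) f = T hf.toOrlicz :=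
  hf.memL1_operatorMeasure.integrationOp_eq
    (hasVectorIntegral_univ_iff.2 hf.cintegral_pairing_operatorMeasure)

end MemOrlicz

theorem vnorm_operatorMeasure_congr {g : α → ℂ} (h : f =ᵐ[m] g) :
    vnorm (operatorMeasure hfin hΦ T) f = vnorm (operatorMeasure hfin hΦ T) g :=
  vnorm_congr fun x' => (pairing_operatorMeasure_absolutelyContinuous x').ae_le h

/-- The truncations of `f` at level `n` are bounded, and approximate `f` by `σ`-additivity of the
integral of `f`. -/
theorem MemL1.exists_memOrlicz_vnorm_sub_lt (hf : MemL1 (operatorMeasure hfin hΦ T) f)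
    (hfm : AEStronglyMeasurable f m) {ε : ℝ≥0∞} (hε : 0 < ε) :
    ∃ g, MemOrlicz Φ m g ∧ vnorm (operatorMeasure hfin hΦ T) (f - g) < ε := by
  let D : ℕ → Set α := fun n => {x | (n : ℝ≥0) < ‖hfm.mk f x‖₊}
  have hD : ∀ n, MeasurableSet (D n) := fun n =>
    measurableSet_lt measurable_const hfm.stronglyMeasurable_mk.measurable.nnnorm
  have hanti : Antitone D := fun i j hij x (hx : (j : ℝ≥0) < _) =>
    (Nat.cast_le.2 hij).trans_lt hx
  have hempty : ⋂ n, D n = ∅ := Set.eq_empty_of_forall_notMem fun x hx => by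
    obtain ⟨n, hn⟩ := exists_nat_ge ‖hfm.mk f x‖₊
    exact hn.not_gt (Set.mem_iInter.1 hx n)
  obtain ⟨n, hn⟩ :=
    ((hf.tendsto_vnorm_indicator hD hanti hempty).eventually_lt_const hε).exists
  refine ⟨(D n)ᶜ.indicator f, memOrlicz_of_bound hfin (hfm.indicator (hD n).compl) n ?_, ?_⟩
  · filter_upwards [hfm.ae_eq_mk] with x hx
    by_cases hxD : x ∈ D n
    · simp [hxD]
    · simpa [hxD, hx] using not_lt.1 hxD
  · rwa [← Set.indicator_compl, compl_compl]

end OperatorMeasure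

section Translates

variable {G : Type*} [Group G] [TopologicalSpace G] [IsTopologicalGroup G]
  [CompactSpace G] [MeasurableSpace G] [BorelSpace G] {m l : Measure G}

theorem integrable_of_continuous {α E : Type*} [TopologicalSpace α] [CompactSpace α]
    [MeasurableSpace α] [OpensMeasurableSpace α] [NormedAddCommGroup E] {g : α → E}
    (hg : Continuous g) (l : Measure α) [IsFiniteMeasureOnCompacts l] : Integrable g l :=
  hg.integrable_of_hasCompactSupport (HasCompactSupport.of_compactSpace g)

theorem lintegral_translates_eq_ofReal (g : C(G, ℝ≥0)) (t : G) [IsFiniteMeasure l] :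
    ∫⁻ s, g (s⁻¹ * t) ∂l = ENNReal.ofReal (∫ s, (g (s⁻¹ * t) : ℝ) ∂l) := by
  rw [ofReal_integral_eq_lintegral_ofReal (integrable_of_continuous (by fun_prop) l)
    (ae_of_all _ fun _ => NNReal.coe_nonneg _)]
  simp only [ENNReal.ofReal_coe_nnreal]

theorem continuous_integral_translates (g : C(G, ℝ≥0)) [IsFiniteMeasure l] :
    Continuous fun t => ∫ s, (g (s⁻¹ * t) : ℝ) ∂l := by
  rw [← continuousOn_univ]
  refine continuousOn_integral_of_compact_support (f := fun t s => (g (s⁻¹ * t) : ℝ))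
    isCompact_univ (Continuous.continuousOn ?_) fun _ x _ hx => absurd (Set.mem_univ x) hx
  unfold Function.uncurry
  fun_prop

theorem continuous_lintegral_translates (g : C(G, ℝ≥0)) [IsFiniteMeasure l] :
    Continuous fun t => ∫⁻ s, g (s⁻¹ * t) ∂l := by
  simp only [lintegral_translates_eq_ofReal]
  exact ENNReal.continuous_ofReal.comp (continuous_integral_translates g)

theorem lintegral_lintegral_translates [m.IsMulLeftInvariant] [IsFiniteMeasure m]
    [IsFiniteMeasure l] (g : C(G, ℝ≥0)) :
    ∫⁻ t, ∫⁻ s, g (s⁻¹ * t) ∂l ∂m = l Set.univ * ∫⁻ t, g t ∂m := by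
  simp only [lintegral_translates_eq_ofReal]
  rw [← ofReal_integral_eq_lintegral_ofReal
      (integrable_of_continuous (continuous_integral_translates g) m)
      (ae_of_all _ fun _ => integral_nonneg fun _ => NNReal.coe_nonneg _),
    integral_integral_swap_of_hasCompactSupport (f := fun t s => (g (s⁻¹ * t) : ℝ))
      (by unfold Function.uncurry; fun_prop) (HasCompactSupport.of_compactSpace _)]
  have integral_translate (s : G) : ∫ t, (g (s⁻¹ * t) : ℝ) ∂m = ∫ t, (g t : ℝ) ∂m :=
    integral_mul_left_eq_self (μ := m) (fun t => (g t : ℝ)) s⁻¹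
  simp_rw [integral_translate, integral_const, smul_eq_mul]
  rw [ENNReal.ofReal_mul measureReal_nonneg, ofReal_measureReal, lintegral_coe_eq_integral _
    (integrable_of_continuous (by fun_prop) m)]

theorem exists_continuous_le_indicator_lt_lintegral {α : Type*} [TopologicalSpace α]
    [CompactSpace α] [T2Space α] [MeasurableSpace α] [BorelSpace α] {l : Measure α} [l.Regular]
    {U : Set α} (hU : IsOpen U) {c : ℝ≥0∞} (hc : c < l U) :
    ∃ g : C(α, ℝ≥0), (∀ x, (g x : ℝ≥0∞) ≤ U.indicator 1 x) ∧ c < ∫⁻ x, g x ∂l := by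
  obtain ⟨K, hKU, hK, hcK⟩ := hU.exists_lt_isCompact hc
  obtain ⟨g, hg0, hg1, hg⟩ := exists_continuous_zero_one_of_isClosed hU.isClosed_compl
    hK.isClosed (Set.disjoint_compl_left_iff_subset.2 hKU)
  have hg' : Continuous fun x => (g x).toNNReal := by fun_prop
  refine ⟨⟨_, hg'⟩, fun x => ?_, hcK.trans_le ?_⟩
  · by_cases hx : x ∈ U
    · simpa [hx] using (hg x).2
    · simpa [hx] using (hg0 hx).le
  · rw [← lintegral_indicator_one hK.measurableSet]
    refine lintegral_mono fun x => ?_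
    by_cases hx : x ∈ K
    · simpa [hx] using (hg1 hx).ge
    · simp [hx]

omit [CompactSpace G] in
theorem lintegral_translates_le_measure {g : C(G, ℝ≥0)} {U : Set G} (hU : IsOpen U)
    (hg : ∀ x, (g x : ℝ≥0∞) ≤ U.indicator 1 x) (t : G) :
    ∫⁻ s, g (s⁻¹ * t) ∂l ≤ l {s | s⁻¹ * t ∈ U} := by
  have hV : IsOpen {s : G | s⁻¹ * t ∈ U} := hU.preimage (by fun_prop)
  rw [← lintegral_indicator_one hV.measurableSet]
  exact lintegral_mono fun s => hg _

variable [T2Space G] [l.Regular] {U : Set G} {c : ℝ≥0∞}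

theorem exists_continuous_le_indicator_lt_lintegral_translates (hU : IsOpen U) {t : G}
    (hc : c < l {s | s⁻¹ * t ∈ U}) :
    ∃ g : C(G, ℝ≥0), (∀ x, (g x : ℝ≥0∞) ≤ U.indicator 1 x) ∧
      c < ∫⁻ s, g (s⁻¹ * t) ∂l := by
  obtain ⟨g, hgU, hcg⟩ := exists_continuous_le_indicator_lt_lintegral
    (hU.preimage (by fun_prop : Continuous fun s : G => s⁻¹ * t)) hc
  refine ⟨⟨fun x => g (t * x⁻¹), by fun_prop⟩, fun x => (hgU _).trans_eq ?_, ?_⟩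
  · by_cases hx : x ∈ U <;> simp [hx]
  · simpa using hcg

theorem isOpen_setOf_lt_measure_translates (hU : IsOpen U) :
    IsOpen {t | c < l {s | s⁻¹ * t ∈ U}} := by
  refine isOpen_iff_mem_nhds.2 fun t ht => ?_
  obtain ⟨g, hg, hgt⟩ := exists_continuous_le_indicator_lt_lintegral_translates hU ht
  filter_upwards [(continuous_lintegral_translates g).continuousAt.eventually
    (lt_mem_nhds hgt)] with t' ht'
  exact ht'.trans_le (lintegral_translates_le_measure hU hg t')

theorem exists_continuous_forall_lt_lintegral_translates (hU : IsOpen U) {K : Set G}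
    (hK : IsCompact K) (hKU : ∀ t ∈ K, c < l {s | s⁻¹ * t ∈ U}) :
    ∃ g : C(G, ℝ≥0), (∀ x, (g x : ℝ≥0∞) ≤ U.indicator 1 x) ∧
      ∀ t ∈ K, c < ∫⁻ s, g (s⁻¹ * t) ∂l := by
  refine hK.induction_on (p := fun K => ∃ g : C(G, ℝ≥0),
    (∀ x, (g x : ℝ≥0∞) ≤ U.indicator 1 x) ∧ ∀ t ∈ K, c < ∫⁻ s, g (s⁻¹ * t) ∂l) ?_ ?_ ?_ ?_
  · exact ⟨0, fun x => by simp, fun _ h => h.elim⟩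
  · rintro K K' hKK' ⟨g, hg, h⟩
    exact ⟨g, hg, fun x hx => h x (hKK' hx)⟩
  · rintro K K' ⟨g, hg, h⟩ ⟨g', hg', h'⟩
    refine ⟨g ⊔ g', fun x => ?_, ?_⟩
    · rw [ContinuousMap.sup_apply, ENNReal.coe_max]
      exact sup_le (hg x) (hg' x)
    · rintro t (ht | ht)
      · exact (h t ht).trans_le (lintegral_mono fun s => by simp)
      · exact (h' t ht).trans_le (lintegral_mono fun s => by simp)
  · intro t ht
    obtain ⟨g, hg, hgt⟩ := exists_continuous_le_indicator_lt_lintegral_translates hU (hKU t ht)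
    exact ⟨_, mem_nhdsWithin_of_mem_nhds ((continuous_lintegral_translates g).continuousAt
      |>.eventually (lt_mem_nhds hgt)), g, hg, fun _ h => h⟩

variable [m.IsMulLeftInvariant] [m.Regular]

-- Without second countability the translates `{(s, t) | s⁻¹ * t ∈ U}` need not belong to the
-- product `σ`-algebra, so Tonelli's theorem is replaced by approximation from below by
-- continuous functions.
theorem mul_measure_translates_le (hU : IsOpen U) :
    c * m {t | c < l {s | s⁻¹ * t ∈ U}} ≤ l Set.univ * m U := by
  rw [(isOpen_setOf_lt_measure_translates hU).measure_eq_iSup_isCompact]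
  simp only [ENNReal.mul_iSup]
  refine iSup₂_le fun K hKU => iSup_le fun hK => ?_
  obtain ⟨g, hg, hgK⟩ := exists_continuous_forall_lt_lintegral_translates hU hK hKU
  calc c * m K ≤ c * m {t | c ≤ ∫⁻ s, g (s⁻¹ * t) ∂l} := by
        gcongr
        exact fun t ht => (hgK t ht).le
    _ ≤ ∫⁻ t, ∫⁻ s, g (s⁻¹ * t) ∂l ∂m :=
        mul_meas_ge_le_lintegral (continuous_lintegral_translates g).measurable c
    _ = l Set.univ * ∫⁻ t, g t ∂m := lintegral_lintegral_translates g
    _ ≤ l Set.univ * m U := by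
        rw [← lintegral_indicator_one hU.measurableSet]
        gcongr with t
        exact hg t

theorem measure_setOf_lt_measure_translates_eq_zero {N : Set G} (hN : m N = 0) (hc : c ≠ 0) :
    m {t | c < l {s | s⁻¹ * t ∈ N}} = 0 := by
  have mul_le_of_pos (ε : ℝ≥0∞) (hε : 0 < ε) :
      c * m {t | c < l {s | s⁻¹ * t ∈ N}} ≤ l Set.univ * ε := by
    obtain ⟨U, hNU, hU, hmU⟩ := Set.exists_isOpen_lt_of_lt N ε (hN ▸ hε)
    calc c * m {t | c < l {s | s⁻¹ * t ∈ N}} ≤ c * m {t | c < l {s | s⁻¹ * t ∈ U}} := by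
          gcongr
      _ ≤ l Set.univ * m U := mul_measure_translates_le hU
      _ ≤ l Set.univ * ε := by gcongr
  have tendsto_zero : Tendsto (fun ε => l Set.univ * ε) (𝓝[>] 0) (𝓝 0) := by
    have := ENNReal.Tendsto.const_mul (tendsto_nhdsWithin_of_tendsto_nhds (s := Set.Ioi 0)
      tendsto_id) (Or.inr (measure_ne_top l Set.univ)) (b := 0)
    rwa [mul_zero] at this
  have := ge_of_tendsto tendsto_zero (eventually_mem_nhdsWithin.mono mul_le_of_pos)
  exact (mul_eq_zero.1 (le_zero_iff.1 this)).resolve_left hc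

theorem ae_ae_translates {p : G → Prop} (hp : ∀ᵐ x ∂m, p x) :
    ∀ᵐ t ∂m, ∀ᵐ s ∂l, p (s⁻¹ * t) := by
  have ae_measure_le : ∀ᵐ t ∂m, ∀ n : ℕ, l {s | ¬ p (s⁻¹ * t)} ≤ (n : ℝ≥0∞)⁻¹ := by
    refine ae_all_iff.2 fun n => ae_iff.2 ?_
    simp only [not_le]
    exact measure_setOf_lt_measure_translates_eq_zero (ae_iff.1 hp)
      (ENNReal.inv_ne_zero.2 (ENNReal.natCast_ne_top n))
  filter_upwards [ae_measure_le] with t ht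
  exact ae_iff.2 (le_zero_iff.1 (ge_of_tendsto' ENNReal.tendsto_inv_nat_nhds_zero ht))

end Translates

section Series

variable {α E : Type*} [MeasurableSpace α] [NormedAddCommGroup E] {m : Measure α}

theorem ae_summable_norm {u : ℕ → α → E} (hu : ∀ n, AEStronglyMeasurable (u n) m)
    (hsum : ∑' n, ∫⁻ x, ‖u n x‖ₑ ∂m ≠ ⊤) : ∀ᵐ x ∂m, Summable fun n => ‖u n x‖ :=
  summable_norm_of_tsum_eLpNorm_ne_top le_rfl hu (by simpa only [eLpNorm_one_eq_lintegral_enorm])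

theorem integrable_tsum [CompleteSpace E] {u : ℕ → α → E}
    (hu : ∀ n, AEStronglyMeasurable (u n) m) (hsum : ∑' n, ∫⁻ x, ‖u n x‖ₑ ∂m ≠ ⊤) :
    Integrable (fun x => ∑' n, u n x) m := by
  refine ⟨aestronglyMeasurable_of_tendsto_ae atTop
    (f := fun n x => ∑ k ∈ Finset.range n, u k x)
    (fun n => Finset.aestronglyMeasurable_fun_sum _ fun k _ => hu k) ?_, ?_⟩
  · filter_upwards [ae_summable_norm hu hsum] with x hx
    exact hx.of_norm.hasSum.tendsto_sum_nat
  · refine (lintegral_mono fun x => enorm_tsum_le_tsum_enorm).trans_lt ?_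
    rw [lintegral_tsum fun n => (hu n).enorm]
    exact hsum.lt_top

theorem ae_tendsto_of_tsum_lintegral_enorm_sub_ne_top {f : α → E} {g : ℕ → α → E}
    (hg : ∀ n, AEStronglyMeasurable (f - g n) m)
    (hsum : ∑' n, ∫⁻ x, ‖f x - g n x‖ₑ ∂m ≠ ⊤) :
    ∀ᵐ x ∂m, Tendsto (fun n => g n x) atTop (𝓝 (f x)) := by
  filter_upwards [ae_summable_norm hg hsum] with x hx
  have := tendsto_zero_iff_norm_tendsto_zero.2 hx.tendsto_atTop_zero
  simpa [Pi.sub_apply] using this.const_sub (f x)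

variable [TopologicalSpace α] [CompactSpace α] [R1Space α] [BorelSpace α] [m.Regular]
  [NormedSpace ℝ E] {f : α → E}

theorem exists_continuous_tsum_lintegral_enorm_sub_le (hf : Integrable f m)
    {ε : ℝ≥0∞} (hε : ε ≠ 0) :
    ∃ g : ℕ → C(α, E), ∑' n, ∫⁻ x, ‖f x - g n x‖ₑ ∂m ≤ ε := by
  obtain ⟨δ, hδ, hδε⟩ := ENNReal.exists_pos_sum_of_countable' hε ℕ
  have exists_le (n : ℕ) : ∃ g : C(α, E), ∫⁻ x, ‖f x - g x‖ₑ ∂m ≤ δ n := by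
    obtain ⟨g, -, hgδ, hg, -⟩ := hf.exists_hasCompactSupport_lintegral_sub_le (hδ n).ne'
    exact ⟨⟨g, hg⟩, hgδ⟩
  choose g hg using exists_le
  exact ⟨g, (ENNReal.tsum_le_tsum hg).trans hδε.le⟩

theorem exists_continuous_ae_hasSum [CompleteSpace E] (hf : Integrable f m) {c : ℝ≥0∞}
    (hc : ∫⁻ x, ‖f x‖ₑ ∂m < c) :
    ∃ u : ℕ → C(α, E), ∑' n, ∫⁻ x, ‖u n x‖ₑ ∂m < c ∧
      ∀ᵐ x ∂m, HasSum (fun n => u n x) (f x) := by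
  obtain ⟨ε, hε, hεc⟩ := ENNReal.lt_iff_exists_add_pos_lt.1 hc
  obtain ⟨g, hgε⟩ := exists_continuous_tsum_lintegral_enorm_sub_le hf
    (ENNReal.half_pos (ENNReal.coe_pos.2 hε).ne').ne'
  let h : ℕ → C(α, E) := fun n => Nat.casesOn n 0 g
  have h_meas (n : ℕ) : AEStronglyMeasurable (fun x => f x - h n x) m :=
    hf.1.sub (integrable_of_continuous (h n).continuous m).1
  have tsum_h : ∑' n, ∫⁻ x, ‖f x - h n x‖ₑ ∂m =
      ∫⁻ x, ‖f x‖ₑ ∂m + ∑' n, ∫⁻ x, ‖f x - g n x‖ₑ ∂m := by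
    rw [tsum_eq_zero_add' ENNReal.summable]
    simp [h]
  have lintegral_le (n : ℕ) : ∫⁻ x, ‖(h (n + 1) - h n) x‖ₑ ∂m ≤
      ∫⁻ x, ‖f x - g n x‖ₑ ∂m + ∫⁻ x, ‖f x - h n x‖ₑ ∂m := by
    rw [← lintegral_add_left' (h_meas (n + 1)).enorm]
    refine lintegral_mono fun x => ?_
    rw [ContinuousMap.sub_apply, ← edist_eq_enorm_sub, ← edist_eq_enorm_sub,
      ← edist_eq_enorm_sub]
    exact edist_triangle_left _ _ _
  have tsum_lt : ∑' n, ∫⁻ x, ‖(h (n + 1) - h n) x‖ₑ ∂m < c := by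
    refine lt_of_le_of_lt ((ENNReal.tsum_le_tsum lintegral_le).trans ?_) hεc
    rw [ENNReal.tsum_add, tsum_h, add_left_comm]
    gcongr
    exact (add_le_add hgε hgε).trans (ENNReal.add_halves ε).le
  refine ⟨fun n => h (n + 1) - h n, tsum_lt, ?_⟩
  have tsum_h_ne_top : ∑' n, ∫⁻ x, ‖f x - h n x‖ₑ ∂m ≠ ⊤ := by
    rw [tsum_h]
    exact ENNReal.add_ne_top.2 ⟨hf.2.ne,
      ne_top_of_le_ne_top (ENNReal.div_ne_top ENNReal.coe_ne_top two_ne_zero) hgε⟩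
  filter_upwards [ae_tendsto_of_tsum_lintegral_enorm_sub_ne_top h_meas tsum_h_ne_top,
    ae_summable_norm (fun n => (integrable_of_continuous (h (n + 1) - h n).continuous m).1)
      tsum_lt.ne_top] with x h_lim h_sum
  refine h_sum.of_norm.hasSum_iff_tendsto_nat.2 ?_
  simpa only [ContinuousMap.sub_apply, Finset.sum_range_sub (fun n => h n x),
    show h 0 x = 0 from rfl, sub_zero] using h_lim

end Series

section ConvolutionSeries

variable {G E : Type*} [Group G] [TopologicalSpace G] [IsTopologicalGroup G]
  [CompactSpace G] [MeasurableSpace G] [BorelSpace G] {m l : Measure G}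
  [m.IsMulLeftInvariant] [IsFiniteMeasure m] [IsFiniteMeasure l] [NormedAddCommGroup E]
  {u : ℕ → C(G, E)}

theorem lintegral_tsum_lintegral_translates (u : ℕ → C(G, E)) :
    ∫⁻ t, ∑' n, ∫⁻ s, ‖u n (s⁻¹ * t)‖ₑ ∂l ∂m =
      l Set.univ * ∑' n, ∫⁻ t, ‖u n t‖ₑ ∂m := by
  let v : ℕ → C(G, ℝ≥0) := fun n => ⟨fun x => ‖u n x‖₊, by fun_prop⟩
  change ∫⁻ t, ∑' n, ∫⁻ s, v n (s⁻¹ * t) ∂l ∂m = l Set.univ * ∑' n, ∫⁻ t, v n t ∂m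
  rw [lintegral_tsum fun n => (continuous_lintegral_translates (v n)).aemeasurable]
  simp only [lintegral_lintegral_translates, ENNReal.tsum_mul_left]

theorem ae_tsum_lintegral_translates_ne_top (hu : ∑' n, ∫⁻ t, ‖u n t‖ₑ ∂m ≠ ⊤) :
    ∀ᵐ t ∂m, ∑' n, ∫⁻ s, ‖u n (s⁻¹ * t)‖ₑ ∂l ≠ ⊤ := by
  let v : ℕ → C(G, ℝ≥0) := fun n => ⟨fun x => ‖u n x‖₊, by fun_prop⟩
  refine (ae_lt_top (f := fun t => ∑' n, ∫⁻ s, ‖u n (s⁻¹ * t)‖ₑ ∂l)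
    (Measurable.tsum fun n => (continuous_lintegral_translates (v n)).measurable)
    ?_).mono fun t ht => ht.ne
  rw [lintegral_tsum_lintegral_translates]
  exact ENNReal.mul_ne_top (measure_ne_top _ _) hu

end ConvolutionSeries

section Convolution

variable {G E : Type*} [Group G] [TopologicalSpace G] [IsTopologicalGroup G]
  [CompactSpace G] [T2Space G] [MeasurableSpace G] [BorelSpace G] {m l : Measure G}
  [m.IsMulLeftInvariant] [m.Regular] [l.Regular] [NormedAddCommGroup E] [NormedSpace ℝ E]
  [CompleteSpace E]

theorem ae_integrable_translates {f : G → E} (hf : Integrable f m) :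
    ∀ᵐ t ∂m, Integrable (fun s => f (s⁻¹ * t)) l := by
  obtain ⟨u, hu, hfu⟩ := exists_continuous_ae_hasSum hf hf.2
  filter_upwards [ae_tsum_lintegral_translates_ne_top (l := l) hu.ne,
    ae_ae_translates (l := l) hfu] with t hut hft
  exact (integrable_tsum (fun n => (integrable_of_continuous (by fun_prop) l).1) hut).congr
    (hft.mono fun s hs => hs.tsum_eq)

theorem lintegral_lintegral_translates_le {F : G → ℝ≥0∞} (hF : AEMeasurable F m) :
    ∫⁻ t, ∫⁻ s, F (s⁻¹ * t) ∂l ∂m ≤ l Set.univ * ∫⁻ t, F t ∂m := by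
  rcases eq_or_ne l 0 with rfl | hl
  · simp
  refine ENNReal.le_mul_of_forall_lt (.inl (Measure.measure_univ_ne_zero.2 hl))
    (.inl (measure_ne_top l _)) fun a ha c hc => ?_
  have F_ne_top : ∫⁻ t, F t ∂m ≠ ⊤ := hc.ne_top
  have enorm_toReal : ∀ᵐ t ∂m, ‖(F t).toReal‖ₑ = F t :=
    (ae_lt_top' hF F_ne_top).mono fun t ht => by simp [ht.ne]
  obtain ⟨u, hu, hFu⟩ := exists_continuous_ae_hasSum
    (integrable_toReal_of_lintegral_ne_top hF F_ne_top)
    ((lintegral_congr_ae enorm_toReal).trans_lt hc)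
  calc ∫⁻ t, ∫⁻ s, F (s⁻¹ * t) ∂l ∂m
      ≤ ∫⁻ t, ∑' n, ∫⁻ s, ‖u n (s⁻¹ * t)‖ₑ ∂l ∂m := by
        refine lintegral_mono_ae (
          (ae_ae_translates (l := l) (enorm_toReal.and hFu)).mono fun t ht => ?_)
        rw [← lintegral_tsum fun n => by fun_prop]
        refine lintegral_mono_ae (ht.mono fun s hs => ?_)
        rw [← hs.1, ← hs.2.tsum_eq]
        exact enorm_tsum_le_tsum_enorm
    _ = l Set.univ * ∑' n, ∫⁻ t, ‖u n t‖ₑ ∂m := lintegral_tsum_lintegral_translates u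
    _ ≤ a * c := by gcongr

end Convolution

section ConvComplex

variable {G : Type*} [Group G]

theorem enorm_conv_le [MeasurableSpace G] (μ : ComplexMeasure G) (f : G → ℂ) (t : G) :
    ‖conv μ f t‖ₑ ≤ ∫⁻ s, ‖f (s⁻¹ * t)‖ₑ ∂μ.variation :=
  enorm_cintegral_le _ _

theorem conv_const_smul [MeasurableSpace G] (μ : ComplexMeasure G) (c : ℂ) (f : G → ℂ) :
    conv μ (c • f) = c • conv μ f :=
  funext fun t => cintegral_const_smul c fun s => f (s⁻¹ * t)

variable [TopologicalSpace G] [IsTopologicalGroup G] [CompactSpace G] [MeasurableSpace G]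
  [BorelSpace G] {μ : ComplexMeasure G}

/-- Integration against a complex measure as a continuous linear functional on `C(G, ℂ)`; it is
taken over `ℝ`, the scalars over which it commutes with the Bochner integral of `C(G, ℂ)`. -/
def cintegralCLM (μ : ComplexMeasure G) : C(G, ℂ) →L[ℝ] ℂ :=
  LinearMap.mkContinuous
    { toFun := fun g => cintegral μ g
      map_add' := fun g h => cintegral_add (integrable_of_continuous g.continuous _)
        (integrable_of_continuous h.continuous _)
      map_smul' := fun c g => cintegral_const_smul (c : ℂ) g }
    (μ.variation.real Set.univ) fun g => by
      calc ‖cintegral μ g‖ ≤ ∫ x, ‖g x‖ ∂μ.variation := norm_cintegral_le μ g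
        _ ≤ ∫ _, ‖g‖ ∂μ.variation :=
          integral_mono (integrable_of_continuous g.continuous _).norm (integrable_const _)
            g.norm_coe_le_norm
        _ = μ.variation.real Set.univ * ‖g‖ := by rw [integral_const, smul_eq_mul]

/-- The translates `t ↦ (s ↦ g(s⁻¹ t))` of a continuous function, as a continuous map into
`C(G, ℂ)`. -/
def translates (g : C(G, ℂ)) : C(G, C(G, ℂ)) :=
  ContinuousMap.curry ⟨fun p : G × G => g (p.2⁻¹ * p.1), by fun_prop⟩

theorem conv_eq_cintegralCLM_translates (g : C(G, ℂ)) (t : G) :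
    conv μ g t = cintegralCLM μ (translates g t) := rfl

theorem continuous_conv (g : C(G, ℂ)) : Continuous (conv μ g) :=
  ((cintegralCLM μ).continuous.comp (translates g).continuous).congr fun t =>
    (conv_eq_cintegralCLM_translates g t).symm

variable {m : Measure G} [m.IsMulLeftInvariant]

theorem integral_translates [IsFiniteMeasure m] (g : C(G, ℂ)) :
    ∫ t, translates g t ∂m = ContinuousMap.const G (∫ t, g t ∂m) := by
  ext s
  rw [ContinuousMap.integral_apply (integrable_of_continuous (translates g).continuous m)]
  exact integral_mul_left_eq_self g s⁻¹

theorem integral_conv_continuous [IsFiniteMeasure m] (g : C(G, ℂ)) :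
    ∫ t, conv μ g t ∂m = μ Set.univ * ∫ t, g t ∂m := by
  simp only [conv_eq_cintegralCLM_translates]
  rw [(cintegralCLM μ).integral_comp_comm
    (integrable_of_continuous (translates g).continuous m), integral_translates]
  exact (VectorMeasure.integral_const (∫ t, g t ∂m)).trans (mul_comm _ _)

theorem tsum_lintegral_enorm_conv_ne_top [IsFiniteMeasure m] {u : ℕ → C(G, ℂ)}
    (hu : ∑' n, ∫⁻ t, ‖u n t‖ₑ ∂m ≠ ⊤) : ∑' n, ∫⁻ t, ‖conv μ (u n) t‖ₑ ∂m ≠ ⊤ := by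
  rw [← lintegral_tsum fun n => (continuous_conv (u n)).aestronglyMeasurable.enorm]
  refine ne_top_of_le_ne_top
    (ENNReal.mul_ne_top (measure_ne_top μ.variation Set.univ) hu) ?_
  rw [← lintegral_tsum_lintegral_translates u]
  exact lintegral_mono fun t => ENNReal.tsum_le_tsum fun n => enorm_conv_le μ (u n) t

variable [T2Space G] [m.Regular] {f g : G → ℂ} [μ.variation.Regular]

theorem conv_congr (h : f =ᵐ[m] g) : conv μ f =ᵐ[m] conv μ g :=
  (ae_ae_translates (l := μ.variation) h).mono fun _ ht => cintegral_congr ht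

theorem conv_add (hf : Integrable f m) (hg : Integrable g m) :
    conv μ (f + g) =ᵐ[m] conv μ f + conv μ g := by
  filter_upwards [ae_integrable_translates (l := μ.variation) hf,
    ae_integrable_translates (l := μ.variation) hg] with t hft hgt
  exact cintegral_add hft hgt

theorem conv_sub (hf : Integrable f m) (hg : Integrable g m) :
    conv μ (f - g) =ᵐ[m] conv μ f - conv μ g := by
  filter_upwards [ae_integrable_translates (l := μ.variation) hf,
    ae_integrable_translates (l := μ.variation) hg] with t hft hgt
  exact cintegral_sub hft hgt

theorem conv_ae_eq_tsum {u : ℕ → C(G, ℂ)} (hu : ∑' n, ∫⁻ t, ‖u n t‖ₑ ∂m ≠ ⊤)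
    (hfu : ∀ᵐ t ∂m, HasSum (fun n => u n t) (f t)) :
    conv μ f =ᵐ[m] fun t => ∑' n, conv μ (u n) t := by
  filter_upwards [ae_tsum_lintegral_translates_ne_top (l := μ.variation) hu,
    ae_ae_translates (l := μ.variation) hfu] with t hut hft
  refine (cintegral_congr (hft.mono fun s hs => hs.tsum_eq.symm)).trans ?_
  exact VectorMeasure.integral_tsum
    (fun n => (integrable_of_continuous (by fun_prop) _).1) hut

theorem aestronglyMeasurable_conv (hf : Integrable f m) : AEStronglyMeasurable (conv μ f) m := by
  obtain ⟨u, hu, hfu⟩ := exists_continuous_ae_hasSum hf hf.2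
  exact (integrable_tsum (fun n => (continuous_conv (u n)).aestronglyMeasurable)
    (tsum_lintegral_enorm_conv_ne_top hu.ne)).1.congr (conv_ae_eq_tsum hu.ne hfu).symm

theorem lintegral_enorm_conv_le (hf : AEStronglyMeasurable f m) :
    ∫⁻ t, ‖conv μ f t‖ₑ ∂m ≤ μ.variation Set.univ * ∫⁻ t, ‖f t‖ₑ ∂m :=
  (lintegral_mono fun t => enorm_conv_le μ f t).trans (lintegral_lintegral_translates_le hf.enorm)

theorem integral_conv (hf : Integrable f m) :
    ∫ t, conv μ f t ∂m = μ Set.univ * ∫ t, f t ∂m := by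
  obtain ⟨u, hu, hfu⟩ := exists_continuous_ae_hasSum hf hf.2
  calc ∫ t, conv μ f t ∂m = ∫ t, ∑' n, conv μ (u n) t ∂m :=
        integral_congr_ae (conv_ae_eq_tsum hu.ne hfu)
    _ = ∑' n, ∫ t, conv μ (u n) t ∂m :=
        integral_tsum (fun n => (continuous_conv (u n)).aestronglyMeasurable)
          (tsum_lintegral_enorm_conv_ne_top hu.ne)
    _ = μ Set.univ * ∑' n, ∫ t, u n t ∂m := by
        simp only [integral_conv_continuous, tsum_mul_left]
    _ = μ Set.univ * ∫ t, ∑' n, u n t ∂m := by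
        rw [integral_tsum (fun n => (integrable_of_continuous (u n).continuous m).1) hu.ne]
    _ = μ Set.univ * ∫ t, f t ∂m := by
        rw [integral_congr_ae (hfu.mono fun t ht => ht.tsum_eq)]

end ConvComplex

section Jensen

variable {Φ : YoungFunction}

theorem YoungFunction.convexOn_toReal (hfin : ∀ x : ℝ≥0, Φ x ≠ ⊤) :
    ConvexOn ℝ (Set.Ici 0) fun x : ℝ => (Φ x.toNNReal).toReal := by
  refine ⟨convex_Ici 0, fun x hx y hy a b ha hb hab => ?_⟩
  lift a to ℝ≥0 using ha
  lift b to ℝ≥0 using hb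
  lift x to ℝ≥0 using hx
  lift y to ℝ≥0 using hy
  have mul_ne_top (c z : ℝ≥0) : c * Φ z ≠ ⊤ := ENNReal.mul_ne_top ENNReal.coe_ne_top (hfin z)
  have toReal_le := ENNReal.toReal_mono (ENNReal.add_ne_top.2 ⟨mul_ne_top a x, mul_ne_top b y⟩)
    (Φ.convex_le (x := x) (y := y) (by exact_mod_cast hab : a + b = 1))
  rw [ENNReal.toReal_add (mul_ne_top a x) (mul_ne_top b y), ENNReal.toReal_mul,
    ENNReal.toReal_mul] at toReal_le
  have toNNReal_eq : (a * x + b * y : ℝ).toNNReal = a * x + b * y := by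
    exact_mod_cast Real.toNNReal_coe (r := a * x + b * y)
  simpa only [smul_eq_mul, toNNReal_eq, Real.toNNReal_coe, ENNReal.coe_toReal] using toReal_le

theorem YoungFunction.continuousOn_toReal (hfin : ∀ x : ℝ≥0, Φ x ≠ ⊤) :
    ContinuousOn (fun x : ℝ => (Φ x.toNNReal).toReal) (Set.Ici 0) := by
  intro x hx
  rcases (Set.mem_Ici.1 hx).eq_or_lt with rfl | hx_pos
  · have tendsto_zero : Tendsto (fun x : ℝ => Φ x.toNNReal) (𝓝 0) (𝓝 0) :=
      (YoungFunction.tendsto_nhds_zero hfin).comp <| by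
        simpa only [Real.toNNReal_zero] using continuous_real_toNNReal.tendsto 0
    have tendsto_toReal := (ENNReal.tendsto_toReal ENNReal.zero_ne_top).comp tendsto_zero
    refine ContinuousAt.continuousWithinAt ?_
    simpa [ContinuousAt, Φ.zero', Function.comp_def] using tendsto_toReal
  · have continuousOn_Ioi := (YoungFunction.convexOn_toReal hfin).continuousOn_interior
    rw [interior_Ici] at continuousOn_Ioi
    exact (continuousOn_Ioi.continuousAt (Ioi_mem_nhds hx_pos)).continuousWithinAt

theorem YoungFunction.map_average_le (hfin : ∀ x : ℝ≥0, Φ x ≠ ⊤) {α : Type*} [MeasurableSpace α]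
    {l : Measure α} [IsFiniteMeasure l] [NeZero l] {h : α → ℝ≥0}
    (hi : Integrable (fun x => (h x : ℝ)) l) :
    Φ (⨍ x, (h x : ℝ) ∂l).toNNReal ≤ ⨍⁻ x, Φ (h x) ∂l := by
  rw [laverage_eq]
  rcases eq_or_ne (∫⁻ x, Φ (h x) ∂l) ⊤ with lintegral_eq | lintegral_ne
  · rw [lintegral_eq, ENNReal.top_div_of_ne_top (measure_ne_top _ _)]
    exact le_top
  have Φh_meas : AEMeasurable (fun x => Φ (h x)) l :=
    Φ.mono.measurable.comp_aemeasurable (by simpa using hi.1.aemeasurable.real_toNNReal)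
  have jensen := (YoungFunction.convexOn_toReal hfin).map_average_le
    (YoungFunction.continuousOn_toReal hfin) isClosed_Ici
    (ae_of_all l fun x => NNReal.coe_nonneg (h x)) hi
    (by simpa only [Function.comp_def, Real.toNNReal_coe]
      using integrable_toReal_of_lintegral_ne_top Φh_meas lintegral_ne)
  simp only [Real.toNNReal_coe] at jensen
  rw [average_eq l (fun x => (Φ (h x)).toReal), integral_toReal Φh_meas
    (ae_of_all _ fun x => (hfin _).lt_top), smul_eq_mul, ← div_eq_inv_mul, Measure.real,
    ← ENNReal.toReal_div] at jensen
  exact (ENNReal.toReal_le_toReal (hfin _)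
    (ENNReal.div_ne_top lintegral_ne (Measure.measure_univ_ne_zero.2 (NeZero.ne l)))).1 jensen

end Jensen

section ConvolutionOperator

variable {G : Type*} [Group G] [MeasurableSpace G] {μ : ComplexMeasure G} {Φ : YoungFunction}
  {f : G → ℂ}

theorem conv_eq_zero_of_variation_eq_zero (hμ : μ.variation = 0) : conv μ f = 0 :=
  funext fun t => enorm_eq_zero.1 <| le_zero_iff.1 <| by simpa [hμ] using enorm_conv_le μ f t

theorem YoungFunction.map_conv_le (hfin : ∀ x : ℝ≥0, Φ x ≠ ⊤) (hμ : μ.variation ≠ 0) {t : G}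
    (ht : Integrable (fun s => f (s⁻¹ * t)) μ.variation) (k : ℝ≥0) :
    Φ (‖conv μ f t‖₊ / (k * (μ.variation Set.univ).toNNReal)) ≤
      ⨍⁻ s, Φ (‖f (s⁻¹ * t)‖₊ / k) ∂μ.variation := by
  have : NeZero μ.variation := ⟨hμ⟩
  have integrable_div : Integrable (fun s => ((‖f (s⁻¹ * t)‖₊ / k : ℝ≥0) : ℝ)) μ.variation := by
    simpa using ht.norm.div_const (k : ℝ)
  refine (Φ.mono (NNReal.le_toNNReal_of_coe_le ?_)).trans
    (YoungFunction.map_average_le hfin integrable_div)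
  calc ((‖conv μ f t‖₊ / (k * (μ.variation Set.univ).toNNReal) : ℝ≥0) : ℝ)
      = ‖conv μ f t‖ / (k * μ.variation.real Set.univ) := rfl
    _ ≤ (∫ s, ‖f (s⁻¹ * t)‖ ∂μ.variation) / (k * μ.variation.real Set.univ) := by
        gcongr
        exact norm_cintegral_le _ _
    _ = ⨍ s, ((‖f (s⁻¹ * t)‖₊ / k : ℝ≥0) : ℝ) ∂μ.variation := by
        simp only [average_eq, smul_eq_mul, NNReal.coe_div, coe_nnnorm, integral_div]
        rw [div_mul_eq_div_div, ← div_eq_inv_mul]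

variable [TopologicalSpace G] [IsTopologicalGroup G] [CompactSpace G] [T2Space G] [BorelSpace G]
  {m : Measure G} [m.IsMulLeftInvariant] [m.Regular] [μ.variation.Regular]

theorem mem_luxSet_conv (hfin : ∀ x : ℝ≥0, Φ x ≠ ⊤) (hμ : μ.variation ≠ 0)
    (hf : AEStronglyMeasurable f m) {k : ℝ≥0} (hk : k ∈ luxSet Φ m f) :
    k * (μ.variation Set.univ).toNNReal ∈ luxSet Φ m (conv μ f) := by
  have variation_univ_ne : μ.variation Set.univ ≠ 0 := Measure.measure_univ_ne_zero.2 hμ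
  have f_int : Integrable f m := MemOrlicz.integrable ⟨hf, eLuxNorm_lt_top_iff.2 ⟨k, hk⟩⟩
  refine ⟨mul_pos hk.1 (ENNReal.toNNReal_pos variation_univ_ne (measure_ne_top _ _)), ?_⟩
  calc ∫⁻ t, Φ (‖conv μ f t‖₊ / (k * (μ.variation Set.univ).toNNReal)) ∂m
      ≤ ∫⁻ t, ⨍⁻ s, Φ (‖f (s⁻¹ * t)‖₊ / k) ∂μ.variation ∂m :=
        lintegral_mono_ae <| (ae_integrable_translates (l := μ.variation) f_int).mono
          fun t ht => YoungFunction.map_conv_le hfin hμ ht k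
    _ = (∫⁻ t, ∫⁻ s, Φ (‖f (s⁻¹ * t)‖₊ / k) ∂μ.variation ∂m) / μ.variation Set.univ := by
        simp only [laverage_eq, div_eq_mul_inv]
        exact lintegral_mul_const' _ _ (ENNReal.inv_ne_top.2 variation_univ_ne)
    _ ≤ (μ.variation Set.univ * ∫⁻ t, Φ (‖f t‖₊ / k) ∂m) / μ.variation Set.univ := by
        gcongr
        exact lintegral_lintegral_translates_le (Φ.aemeasurable_comp_nnnorm_div hf k)
    _ = ∫⁻ t, Φ (‖f t‖₊ / k) ∂m := by
        rw [mul_comm, ENNReal.mul_div_cancel_right variation_univ_ne (measure_ne_top _ _)]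
    _ ≤ 1 := hk.2

theorem eLuxNorm_conv_le (hfin : ∀ x : ℝ≥0, Φ x ≠ ⊤) (hf : AEStronglyMeasurable f m) :
    eLuxNorm Φ m (conv μ f) ≤ μ.variation Set.univ * eLuxNorm Φ m f := by
  rcases eq_or_ne μ.variation 0 with hμ | hμ
  · rw [conv_eq_zero_of_variation_eq_zero hμ, eLuxNorm_zero]
    exact zero_le
  refine ENNReal.le_mul_of_forall_lt (.inl (Measure.measure_univ_ne_zero.2 hμ))
    (.inl (measure_ne_top _ _)) fun a ha b hb => ?_
  obtain ⟨k, hk, hkb⟩ := eLuxNorm_lt_iff.1 hb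
  calc eLuxNorm Φ m (conv μ f) ≤ (k * (μ.variation Set.univ).toNNReal : ℝ≥0) :=
        eLuxNorm_le_of_mem_luxSet (mem_luxSet_conv hfin hμ hf hk)
    _ = μ.variation Set.univ * k := by
        rw [ENNReal.coe_mul, ENNReal.coe_toNNReal (measure_ne_top _ _), mul_comm]
    _ ≤ a * b := by gcongr

theorem MemOrlicz.conv (hfin : ∀ x : ℝ≥0, Φ x ≠ ⊤) (hf : MemOrlicz Φ m f) :
    MemOrlicz Φ m (conv μ f) :=
  ⟨aestronglyMeasurable_conv hf.integrable, (eLuxNorm_conv_le hfin hf.1).trans_lt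
    (ENNReal.mul_lt_top (measure_lt_top _ _) hf.2)⟩

variable (μ m) in
/-- The operator `f ↦ μ * f` on the Orlicz space, whose norm is at most `|μ|(G)`. -/
def convOp (hfin : ∀ x : ℝ≥0, Φ x ≠ ⊤) : OrliczSpace Φ m →L[ℂ] OrliczSpace Φ m :=
  LinearMap.mkContinuous
    { toFun := fun u => ((OrliczSpace.memOrlicz u).conv (μ := μ) hfin).toOrlicz
      map_add' := fun u v => by
        have hu := OrliczSpace.memOrlicz u
        have hv := OrliczSpace.memOrlicz v
        rw [← MemOrlicz.toOrlicz_add]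
        exact MemOrlicz.toOrlicz_congr _ _ <|
          (conv_congr (AEEqFun.coeFn_add u.1 v.1)).trans (conv_add hu.integrable hv.integrable)
      map_smul' := fun c u => by
        rw [RingHom.id_apply, ← MemOrlicz.toOrlicz_const_smul]
        refine MemOrlicz.toOrlicz_congr _ _ ?_
        rw [← conv_const_smul]
        exact conv_congr (AEEqFun.coeFn_smul c u.1) }
    (μ.variation.real Set.univ) fun u => by
      change ‖((OrliczSpace.memOrlicz u).conv hfin).toOrlicz‖ ≤ _
      rw [← toReal_enorm, ← toReal_enorm, Measure.real, ← ENNReal.toReal_mul,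
        MemOrlicz.enorm_toOrlicz, OrliczSpace.enorm_eq_eLuxNorm]
      exact ENNReal.toReal_mono
        (ENNReal.mul_ne_top (measure_ne_top _ _) (OrliczSpace.memOrlicz u).2.ne)
        (eLuxNorm_conv_le hfin (OrliczSpace.memOrlicz u).1)

theorem coe_convOp (hfin : ∀ x : ℝ≥0, Φ x ≠ ⊤) (u : OrliczSpace Φ m) :
    ((convOp μ m hfin u : OrliczSpace Φ m) : G →ₘ[m] ℂ) =ᵐ[m] conv μ (u : G →ₘ[m] ℂ) :=
  ((OrliczSpace.memOrlicz u).conv hfin).coeFn_toOrlicz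

end ConvolutionOperator

section IntegralFunctional

variable {α : Type*} [MeasurableSpace α]

/-- Integration against a finite measure, as a continuous linear functional on the Orlicz space. -/
def integralDual (Φ : YoungFunction) (m : Measure α) [IsFiniteMeasure m] :
    StrongDual ℂ (OrliczSpace Φ m) :=
  LinearMap.mkContinuousOfExistsBound
    { toFun := fun u => ∫ x, (u : α →ₘ[m] ℂ) x ∂m
      map_add' := fun u v => (integral_congr_ae (AEEqFun.coeFn_add u.1 v.1)).trans <|
        integral_add (OrliczSpace.memOrlicz u).integrable (OrliczSpace.memOrlicz v).integrable
      map_smul' := fun c u => (integral_congr_ae (AEEqFun.coeFn_smul c u.1)).trans <|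
        integral_smul c _ } <| by
    obtain ⟨C, hC⟩ := exists_lintegral_enorm_le_mul_eLuxNorm Φ m
    refine ⟨C, fun u => ?_⟩
    have enorm_le := (enorm_integral_le_lintegral_enorm _).trans (hC (u : α →ₘ[m] ℂ))
    rw [← OrliczSpace.enorm_eq_eLuxNorm] at enorm_le
    exact ENNReal.coe_le_coe.1 (enorm_le.trans_eq (ENNReal.coe_mul _ _).symm)

theorem integralDual_apply {Φ : YoungFunction} {m : Measure α} [IsFiniteMeasure m]
    (u : OrliczSpace Φ m) : integralDual Φ m u = ∫ x, (u : α →ₘ[m] ℂ) x ∂m :=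
  rfl

end IntegralFunctional

section ConvolutionMeasure

variable {G : Type*} [Group G] [TopologicalSpace G] [IsTopologicalGroup G]
  [CompactSpace G] [T2Space G] [MeasurableSpace G] [BorelSpace G]
  {m : Measure G} [m.IsMulLeftInvariant] [m.Regular]
  {Φ : YoungFunction} {hfin : ∀ x : ℝ≥0, Φ x ≠ ⊤} {hΦ : DeltaTwo Φ}
  {μ : ComplexMeasure G} [μ.variation.Regular] {f g : G → ℂ}

local notation "ν" => operatorMeasure hfin hΦ (convOp μ m hfin)

theorem coe_convOp_toOrlicz (hf : MemOrlicz Φ m f) :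
    ((convOp μ m hfin hf.toOrlicz : OrliczSpace Φ m) : G →ₘ[m] ℂ) =ᵐ[m] conv μ f :=
  (coe_convOp hfin _).trans (conv_congr hf.coeFn_toOrlicz)

theorem pairing_convOp_integralDual {A : Set G} (hA : MeasurableSet A) :
    pairing ν (integralDual Φ m) A = μ Set.univ * m.real A := by
  have memOrlicz_one := memOrlicz_indicator_one (Φ := Φ) (m := m) hfin hA
  rw [pairing_apply, operatorMeasure_apply hA, integralDual_apply,
    integral_congr_ae (coe_convOp_toOrlicz memOrlicz_one), integral_conv memOrlicz_one.integrable,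
    Pi.one_def, integral_indicator_const _ hA, Complex.real_smul, mul_one]

theorem isNull_convOp_iff (hμ : μ Set.univ ≠ 0) {A : Set G} (hA : MeasurableSet A) :
    IsNull ν A ↔ m A = 0 := by
  refine ⟨fun h => ?_, fun h B _ hBA => operatorMeasure_eq_zero (measure_mono_null hBA h)⟩
  have mul_eq := pairing_convOp_integralDual (hfin := hfin) (hΦ := hΦ) (μ := μ) (m := m) hA
  rw [pairing_apply, h A hA subset_rfl, map_zero, zero_eq_mul] at mul_eq
  simpa [measureReal_eq_zero_iff] using mul_eq.resolve_left hμ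

theorem smul_le_variation_pairing_integralDual :
    ‖μ Set.univ‖ₑ • m ≤ (pairing ν (integralDual Φ m)).variation := by
  refine Measure.le_iff.2 fun A hA => ?_
  calc (‖μ Set.univ‖ₑ • m) A = ‖pairing ν (integralDual Φ m) A‖ₑ := by
        rw [pairing_convOp_integralDual hA, enorm_mul, Measure.smul_apply, smul_eq_mul,
          ← ofReal_norm (m.real A : ℂ), Complex.norm_real, Real.norm_of_nonneg measureReal_nonneg,
          ofReal_measureReal]
    _ ≤ (pairing ν (integralDual Φ m)).variation A := VectorMeasure.enorm_measure_le_variation _ A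

theorem MemL1.integrable_of_convOp (hμ : μ Set.univ ≠ 0) (hf : MemL1 ν f) : Integrable f m :=
  (integrable_smul_measure (enorm_ne_zero.2 hμ) enorm_ne_top).1 <|
    (hf.1 (integralDual Φ m)).mono_measure smul_le_variation_pairing_integralDual

theorem exists_lintegral_enorm_le_mul_vnorm (hμ : μ Set.univ ≠ 0) :
    ∃ C : ℝ≥0∞, C ≠ ⊤ ∧ ∀ f : G → ℂ, ∫⁻ t, ‖f t‖ₑ ∂m ≤ C * vnorm ν f := by
  refine ⟨‖integralDual Φ m‖ₑ / ‖μ Set.univ‖ₑ,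
    ENNReal.div_ne_top enorm_ne_top (enorm_ne_zero.2 hμ), fun f => ?_⟩
  rw [← ENNReal.mul_div_right_comm,
    ENNReal.le_div_iff_mul_le (.inl (enorm_ne_zero.2 hμ)) (.inl enorm_ne_top), mul_comm]
  calc ‖μ Set.univ‖ₑ * ∫⁻ t, ‖f t‖ₑ ∂m = ∫⁻ t, ‖f t‖ₑ ∂(‖μ Set.univ‖ₑ • m) := by
        rw [lintegral_smul_measure, smul_eq_mul]
    _ ≤ ∫⁻ t, ‖f t‖ₑ ∂(pairing ν (integralDual Φ m)).variation :=
        lintegral_mono' smul_le_variation_pairing_integralDual le_rfl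
    _ ≤ ‖integralDual Φ m‖ₑ * vnorm ν f := lintegral_variation_pairing_le _ _ f

theorem exists_lintegral_enorm_integrationOp_sub_conv_le (hμ : μ Set.univ ≠ 0) :
    ∃ C : ℝ≥0∞, C ≠ ⊤ ∧ ∀ f : G → ℂ, MemL1 ν f →
      ∫⁻ t, ‖((integrationOp ν f : OrliczSpace Φ m) : G →ₘ[m] ℂ) t - conv μ f t‖ₑ ∂m ≤
        C * vnorm ν f := by
  obtain ⟨C, hC⟩ := exists_lintegral_enorm_le_mul_eLuxNorm Φ m
  obtain ⟨D, hD_ne_top, hD⟩ :=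
    exists_lintegral_enorm_le_mul_vnorm (hfin := hfin) (hΦ := hΦ) (m := m) hμ
  refine ⟨C + μ.variation Set.univ * D, by finiteness, fun f hf => ?_⟩
  set u : OrliczSpace Φ m := integrationOp ν f
  calc ∫⁻ t, ‖(u : G →ₘ[m] ℂ) t - conv μ f t‖ₑ ∂m
      ≤ ∫⁻ t, ‖(u : G →ₘ[m] ℂ) t‖ₑ + ‖conv μ f t‖ₑ ∂m := lintegral_mono fun _ => enorm_sub_le
    _ = ∫⁻ t, ‖(u : G →ₘ[m] ℂ) t‖ₑ ∂m + ∫⁻ t, ‖conv μ f t‖ₑ ∂m :=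
        lintegral_add_left' (AEEqFun.aestronglyMeasurable _).enorm _
    _ ≤ C * vnorm ν f + μ.variation Set.univ * (D * vnorm ν f) := by
        gcongr
        · exact (hC _).trans <| mul_le_mul_right
            ((OrliczSpace.enorm_eq_eLuxNorm u).symm.trans_le hf.enorm_integrationOp_le) _
        · exact (lintegral_enorm_conv_le (hf.integrable_of_convOp hμ).1).trans
            (mul_le_mul_right (hD f) _)
    _ = (C + μ.variation Set.univ * D) * vnorm ν f := by rw [add_mul, mul_assoc]

theorem integrationOp_sub_conv_ae_eq (hμ : μ Set.univ ≠ 0) (hf : MemL1 ν f)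
    (hg : MemOrlicz Φ m g) :
    (fun t => ((integrationOp ν (f - g) : OrliczSpace Φ m) : G →ₘ[m] ℂ) t - conv μ (f - g) t)
      =ᵐ[m] fun t => ((integrationOp ν f : OrliczSpace Φ m) : G →ₘ[m] ℂ) t - conv μ f t := by
  have integrationOp_g := hg.integrationOp_operatorMeasure (hfin := hfin) (hΦ := hΦ)
    (T := convOp μ m hfin)
  rw [hf.integrationOp_sub hg.memL1_operatorMeasure, integrationOp_g]
  filter_upwards [AEEqFun.coeFn_sub (integrationOp ν f).1 (convOp μ m hfin hg.toOrlicz).1,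
    coe_convOp_toOrlicz (hfin := hfin) (μ := μ) hg,
    conv_sub (μ := μ) (hf.integrable_of_convOp hμ) hg.integrable]
    with t coe_sub_apply convOp_apply conv_sub_apply
  rw [AddSubgroupClass.coe_sub, coe_sub_apply, conv_sub_apply, Pi.sub_apply, Pi.sub_apply,
    convOp_apply, sub_sub_sub_cancel_right]

theorem coe_integrationOp_convOp (hμ : μ Set.univ ≠ 0) (hf : MemL1 ν f) :
    ((integrationOp ν f : OrliczSpace Φ m) : G →ₘ[m] ℂ) =ᵐ[m] conv μ f := by
  have f_int := hf.integrable_of_convOp hμ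
  obtain ⟨C, hC_ne_top, hC⟩ := exists_lintegral_enorm_integrationOp_sub_conv_le
    (hfin := hfin) (hΦ := hΦ) (m := m) hμ
  suffices lintegral_eq :
      ∫⁻ t, ‖((integrationOp ν f : OrliczSpace Φ m) : G →ₘ[m] ℂ) t - conv μ f t‖ₑ ∂m = 0 by
    have sub_ae_zero := (lintegral_eq_zero_iff' ((AEEqFun.aestronglyMeasurable _).sub
      (aestronglyMeasurable_conv f_int)).enorm).1 lintegral_eq
    exact sub_ae_zero.mono fun t ht => sub_eq_zero.1 (enorm_eq_zero.1 ht)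
  by_contra lintegral_ne
  obtain ⟨g, hg, vnorm_lt⟩ := hf.exists_memOrlicz_vnorm_sub_lt f_int.1
    (ENNReal.div_pos lintegral_ne hC_ne_top)
  refine (ENNReal.mul_lt_of_lt_div' vnorm_lt).not_ge ?_
  rw [← lintegral_congr_ae ((integrationOp_sub_conv_ae_eq hμ hf hg).mono fun _ ht =>
    congrArg enorm ht)]
  exact hC _ (hf.sub hg.memL1_operatorMeasure)

end ConvolutionMeasure

end OrliczConv

end

open OrliczConv in
theorem mainTheorem10_general {G : Type*} [Group G] [TopologicalSpace G] [IsTopologicalGroup G]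
    [CompactSpace G] [T2Space G] [MeasurableSpace G] [BorelSpace G]
    (m : Measure G) [m.IsMulLeftInvariant] [m.Regular]
    (Φ : YoungFunction) (hfin : ∀ x : ℝ≥0, Φ x ≠ ⊤) (hΦ : DeltaTwo Φ)
    (μ : ComplexMeasure G) [μ.variation.Regular] (hμ : μ Set.univ ≠ 0) :
    ∃ (T : OrliczSpace Φ m →L[ℂ] OrliczSpace Φ m)
      (ν : VectorMeasure G (OrliczSpace Φ m)),
      (∀ f : OrliczSpace Φ m,
        (∀ᵐ t ∂m, Integrable (fun s => (f : G →ₘ[m] ℂ) (s⁻¹ * t)) μ.variation) ∧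
        (T f : G →ₘ[m] ℂ) =ᵐ[m] conv μ (f : G →ₘ[m] ℂ)) ∧
      (∀ A, MeasurableSet A → ∃ c : OrliczSpace Φ m,
        (c : G →ₘ[m] ℂ) =ᵐ[m] A.indicator 1 ∧ ν A = T c) ∧
      (∀ A, MeasurableSet A → (IsNull ν A ↔ m A = 0)) ∧
      (∀ f : G → ℂ, MemL1 ν f → vnorm ν f < ⊤) ∧
      (∀ f : OrliczSpace Φ m, MemL1 ν (f : G →ₘ[m] ℂ)) ∧
      (∀ f : G → ℂ, MemL1 ν f → ∀ ε : ℝ≥0∞, 0 < ε →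
        ∃ g : OrliczSpace Φ m, vnorm ν (f - (g : G →ₘ[m] ℂ)) < ε) ∧
      (∀ f : OrliczSpace Φ m, integrationOp ν (f : G →ₘ[m] ℂ) = T f) ∧
      (∀ f : G → ℂ, MemL1 ν f → ‖integrationOp ν f‖ₑ ≤ vnorm ν f) ∧
      (∀ f : G → ℂ, MemL1 ν f →
        (∀ᵐ t ∂m, Integrable (fun s => f (s⁻¹ * t)) μ.variation) ∧
        ((integrationOp ν f : OrliczSpace Φ m) : G →ₘ[m] ℂ) =ᵐ[m] conv μ f) := by
  let T := convOp μ m (Φ := Φ) hfin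
  refine ⟨T, operatorMeasure hfin hΦ T,
    fun f => ⟨ae_integrable_translates (OrliczSpace.memOrlicz f).integrable, coe_convOp hfin f⟩,
    fun A hA => ⟨(memOrlicz_indicator_one hfin hA).toOrlicz, MemOrlicz.coeFn_toOrlicz _,
      operatorMeasure_apply hA⟩,
    fun A hA => isNull_convOp_iff hμ hA,
    fun f hf => hf.vnorm_lt_top, fun f => (OrliczSpace.memOrlicz f).memL1_operatorMeasure,
    fun f hf ε hε => ?_, fun f => ?_, fun f hf => hf.enorm_integrationOp_le,
    fun f hf => ⟨ae_integrable_translates (hf.integrable_of_convOp hμ),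
      coe_integrationOp_convOp hμ hf⟩⟩
  · obtain ⟨g, hg, vnorm_lt⟩ :=
      hf.exists_memOrlicz_vnorm_sub_lt (hf.integrable_of_convOp hμ).1 hε
    have sub_ae_eq := (ae_eq_refl f).sub hg.coeFn_toOrlicz
    exact ⟨hg.toOrlicz, (vnorm_operatorMeasure_congr sub_ae_eq).trans_lt vnorm_lt⟩
  · rw [(OrliczSpace.memOrlicz f).integrationOp_operatorMeasure, OrliczSpace.toOrlicz_memOrlicz]

theorem mainTheorem10 {G : Type*} [Group G] [TopologicalSpace G] [IsTopologicalGroup G]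
    [CompactSpace G] [T2Space G] [MeasurableSpace G] [BorelSpace G]
    (m : Measure G) [m.IsHaarMeasure] [m.Regular] [IsProbabilityMeasure m]
    (Φ : OrliczConv.YoungFunction) (hfin : ∀ x : ℝ≥0, Φ x ≠ ⊤)
    (hΦ : OrliczConv.DeltaTwo Φ)
    (hΨ : OrliczConv.DeltaTwo (OrliczConv.complementary Φ))
    (μ : ComplexMeasure G) (hreg : μ.variation.Regular) (hμ : μ Set.univ ≠ 0) :
    ∃ (T : OrliczConv.OrliczSpace Φ m →L[ℂ] OrliczConv.OrliczSpace Φ m)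
      (ν : VectorMeasure G (OrliczConv.OrliczSpace Φ m)),
      -- `T` is the convolution operator `f ↦ μ * f`
      (∀ f : OrliczConv.OrliczSpace Φ m,
        (∀ᵐ t ∂m, Integrable (fun s => (f : G →ₘ[m] ℂ) (s⁻¹ * t)) μ.variation) ∧
        (T f : G →ₘ[m] ℂ) =ᵐ[m] OrliczConv.conv μ (f : G →ₘ[m] ℂ)) ∧
      -- `ν` is the vector measure `A ↦ T(χ_A)` associated with `T`
      (∀ A, MeasurableSet A → ∃ c : OrliczConv.OrliczSpace Φ m,
        (c : G →ₘ[m] ℂ) =ᵐ[m] A.indicator 1 ∧ ν A = T c) ∧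
      -- `ν` and `m` have the same null sets, so classes modulo `ν` and modulo `m` agree
      (∀ A, MeasurableSet A → (OrliczConv.IsNull ν A ↔ m A = 0)) ∧
      -- the seminorm of `L¹(ν)` is finite
      (∀ f : G → ℂ, OrliczConv.MemL1 ν f → OrliczConv.vnorm ν f < ⊤) ∧
      -- `L^Φ(G)` is contained in `L¹(ν)` and dense there
      (∀ f : OrliczConv.OrliczSpace Φ m, OrliczConv.MemL1 ν (f : G →ₘ[m] ℂ)) ∧
      (∀ f : G → ℂ, OrliczConv.MemL1 ν f → ∀ ε : ℝ≥0∞, 0 < ε →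
        ∃ g : OrliczConv.OrliczSpace Φ m, OrliczConv.vnorm ν (f - (g : G →ₘ[m] ℂ)) < ε) ∧
      -- the integration operator is a continuous extension of `T` to `L¹(ν)` ...
      (∀ f : OrliczConv.OrliczSpace Φ m,
        OrliczConv.integrationOp ν (f : G →ₘ[m] ℂ) = T f) ∧
      (∀ f : G → ℂ, OrliczConv.MemL1 ν f →
        ‖OrliczConv.integrationOp ν f‖ₑ ≤ OrliczConv.vnorm ν f) ∧
      -- ... and is given by `f ↦ μ * f`
      (∀ f : G → ℂ, OrliczConv.MemL1 ν f →
        (∀ᵐ t ∂m, Integrable (fun s => f (s⁻¹ * t)) μ.variation) ∧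
        ((OrliczConv.integrationOp ν f : OrliczConv.OrliczSpace Φ m) : G →ₘ[m] ℂ) =ᵐ[m] OrliczConv.conv μ f) :=
  mainTheorem10_general m Φ hfin hΦ μ hμ
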